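/- Let $F\in\mathbb{Z}[x_1,x_2,x_3,x_4]$ be a non-singular homogeneous polynomial of degree $k\ge 3$ (that is, $F$ and its four partial derivatives have no common zero in $\mathbb{C}^4\setminus\{0\}$). For $N\in\mathbb{N}$, a real number $B\ge 1$ and an integer $\delta\ge 1$, let $\mathcal{A}(F,N,B,\delta)$ be the smallest possible cardinality of a finite set $\mathcal{C}$ of non-zero homogeneous polynomials in $\mathbb{Z}[x_1,x_2,x_3,x_4]$, all of degree $\delta$ (auxiliary forms), such that every $\mathbf{x}\in\mathbb{Z}^4\cap[-B,B]^4$ with $|F(\mathbf{x})|\le N$ satisfies $A(\mathbf{x})=0$ for at least one $A\in\mathcal{C}$. For every integer $k\ge 3$ and every $\varepsilon>0$ there is an integer $\delta\ge 1$, depending only on $k$ and $\varepsilon$, such that for every non-singular form $F\in\mathbb{Z}[x_1,x_2,x_3,x_4]$ of degree $k$, every $N\in\mathbb{N}$ and every real $B\ge 1$, $$\mathcal{A}(F,N,B,\delta)=O_{F,N,\varepsilon}\left(B^{16/(3\sqrt{3k})+\varepsilon}\right),$$ where the implied constant depends only on $F$, $N$ and $\varepsilon$ (and not on $B$). -/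

import Mathlib

open MvPolynomial

/-- For a homogeneous `F ∈ ℤ[x₁,x₂,x₃,x₄]`: the projective surface `F = 0` is non-singular, that is,
`F` and its four partial derivatives have no common zero in `ℂ⁴` other than the origin. -/
def IsNonsingularForm (F : MvPolynomial (Fin 4) ℤ) : Prop :=
  ∀ z : Fin 4 → ℂ, aeval z F = 0 → (∀ i, aeval z (pderiv i F) = 0) → z = 0

/-- The integral points `x ∈ ℤ⁴ ∩ [-B,B]⁴` with `|F(x)| ≤ N`. -/
def nearPoints (F : MvPolynomial (Fin 4) ℤ) (N : ℕ) (B : ℝ) : Set (Fin 4 → ℤ) :=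
  {x | (∀ i, |(x i : ℝ)| ≤ B) ∧ |eval x F| ≤ (N : ℤ)}

/-- `C` is a finite collection of auxiliary forms of degree `δ`: non-zero integral homogeneous
polynomials of the same degree `δ` such that every point of `nearPoints F N B` is a zero of
at least one of them. -/
def IsAuxiliaryCollection (F : MvPolynomial (Fin 4) ℤ) (N : ℕ) (B : ℝ) (δ : ℕ)
    (C : Finset (MvPolynomial (Fin 4) ℤ)) : Prop :=
  (∀ A ∈ C, A ≠ 0 ∧ A.IsHomogeneous δ) ∧ ∀ x ∈ nearPoints F N B, ∃ A ∈ C, eval x A = 0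

/-- The smallest possible cardinality `𝒜(F,N,B,δ)` of a collection of auxiliary forms of degree `δ`.
For `δ ≥ 1` the minimum is over a non-empty set, see `auxiliaryNumber_attained`. -/
noncomputable def auxiliaryNumber (F : MvPolynomial (Fin 4) ℤ) (N : ℕ) (B : ℝ) (δ : ℕ) : ℕ :=
  sInf {n : ℕ | ∃ C, IsAuxiliaryCollection F N B δ C ∧ C.card = n}

theorem nearPoints_finite (F : MvPolynomial (Fin 4) ℤ) (N : ℕ) (B : ℝ) :
    (nearPoints F N B).Finite := by
  refine (Set.Finite.pi (fun _ : Fin 4 => Set.finite_Icc (-⌈B⌉) ⌈B⌉)).subset ?_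
  intro x hx i _
  have h := abs_le.1 (hx.1 i)
  have hB := Int.le_ceil B
  constructor
  · have : (-(⌈B⌉ : ℝ)) ≤ (x i : ℝ) := by linarith
    exact_mod_cast this
  · have : (x i : ℝ) ≤ (⌈B⌉ : ℝ) := by linarith
    exact_mod_cast this

theorem exists_form_vanishing {δ : ℕ} (hδ : 0 < δ) (x : Fin 4 → ℤ) :
    ∃ A : MvPolynomial (Fin 4) ℤ, (A ≠ 0 ∧ A.IsHomogeneous δ) ∧ eval x A = 0 := by
  obtain ⟨L, hL0, hL1, hLx⟩ : ∃ L : MvPolynomial (Fin 4) ℤ,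
      L ≠ 0 ∧ L.IsHomogeneous 1 ∧ eval x L = 0 := by
    by_cases h : x 0 = 0
    · exact ⟨X 0, X_ne_zero _, isHomogeneous_X _ _, by simpa using h⟩
    · refine ⟨C (x 1) * X 0 - C (x 0) * X 1, ?_, ?_, by simp [mul_comm]⟩
      · intro h0
        have := congrArg (eval ![0, 1, 0, 0]) h0
        simp at this
        exact h this
      · exact (isHomogeneous_C_mul_X _ _).sub (isHomogeneous_C_mul_X _ _)
  refine ⟨L ^ δ, ⟨pow_ne_zero _ hL0, ?_⟩, by simp [hLx, hδ.ne']⟩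
  simpa using hL1.pow δ

/-- For `δ ≥ 1` the number `𝒜(F,N,B,δ)` is well defined: it is attained by a collection. -/
theorem auxiliaryNumber_attained (F : MvPolynomial (Fin 4) ℤ) (N : ℕ) (B : ℝ) {δ : ℕ}
    (hδ : 0 < δ) : ∃ C, IsAuxiliaryCollection F N B δ C ∧ C.card = auxiliaryNumber F N B δ := by
  classical
  refine Nat.sInf_mem (s := {n : ℕ | ∃ C, IsAuxiliaryCollection F N B δ C ∧ C.card = n}) ?_
  choose A hA hAx using exists_form_vanishing hδ
  refine ⟨_, (nearPoints_finite F N B).toFinset.image A, ⟨?_, ?_⟩, rfl⟩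
  · intro P hP
    obtain ⟨x, -, rfl⟩ := Finset.mem_image.1 hP
    exact hA x
  · intro x hx
    exact ⟨A x, Finset.mem_image_of_mem _ ((nearPoints_finite F N B).mem_toFinset.2 hx), hAx x⟩

/-!
The proof is a determinant-free version of the determinant method for integral points near a
surface.

Points `x` with `R / 2 < max |xᵢ| ≤ R` and `|F x| ≤ N` are rescaled by their largest coordinate,
which after a permutation is the last one, to points `t` of the cube `[-1,1]³` that satisfy
`|f t| = O(R ^ (-k))`, where `f` is the dehomogenization of `F`. Non-singularity, Euler's identity
and compactness (`exists_partial_derivative_bound`) allow one to assume that `∂f/∂x₂` is bounded away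
from zero at `t`. The points `t` then fall into `O(R ^ (2 * r))` patches of radius
`O(R ^ (-r))`: a patch is determined, up to boundedly many choices, by a square of side `R ^ (-r)`
for the first two coordinates (`exists_patch_bound`).

On a patch with centre `a`, put `τ = t - a` and `u = f t - f a`. The relation between `u` and `τ`
can be solved for `τ 2`, so a monomial of degree `δ` in `x`, divided by `x₃ ^ δ`, is up to a
negligible error a polynomial in `τ 0`, `τ 1` and `u`, with coefficients bounded independently of
the patch (`exists_expansion`). The monomial of exponent `m` in these quantities is `O(R ^ (-w m))`
with `w m = r * (m 0 + m 1) + k * m 2`. A pigeonhole argument (`exists_small_combination`) over the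
`R ^ ((W - δ) * s)` forms of degree `δ` with coefficients up to `R ^ (W - δ)`, where `s` is the
number of monomials of degree `δ`, gives a non-zero form `A` with `|A x| < 1`, hence `A x = 0`, at
all points of the patch, as soon as `∑ (W - w m)₊ < s * (W - δ)`. Here the left side is
asymptotically `W ^ 4 / (24 * r ^ 2 * k)` and `s` is asymptotically `δ ^ 3 / 6`, so that with
`W = 4 / 3 * δ` and large `δ` the condition becomes `64 / 27 < r ^ 2 * k`. The infimum of the
admissible values of `2 * r` is `16 / (3 * √(3 * k))`. Summing over dyadic values of `R` gives the bound.
-/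

/-! ### Polynomial substitutions modulo powers of the ideal of the variables -/

section Substitution

variable {σ A : Type*} [CommRing A]

/-- An endomorphism which is the identity on the variables up to second order raises the order of
`q - θ q` by one. -/
theorem sub_mem_pow_succ_of_sub_X_mem_sq
    (θ : MvPolynomial σ A →ₐ[A] MvPolynomial σ A)
    (hθ : ∀ i, X i - θ (X i) ∈ idealOfVars σ A ^ 2) (n : ℕ) :
    (∀ q ∈ idealOfVars σ A ^ n, θ q ∈ idealOfVars σ A ^ n) ∧
      ∀ q ∈ idealOfVars σ A ^ n, q - θ q ∈ idealOfVars σ A ^ (n + 1) := by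
  set I := idealOfVars σ A with hI
  have hX : ∀ i, (X i : MvPolynomial σ A) ∈ I := fun i => Ideal.subset_span ⟨i, rfl⟩
  have hsq : I ^ 2 ≤ I := Ideal.pow_le_self two_ne_zero
  have hθX : ∀ i, θ (X i) ∈ I := fun i => by
    have := I.sub_mem (hX i) (hsq (hθ i)); simpa using this
  have h0 : ∀ q, q - θ q ∈ I := by
    intro q
    induction q using MvPolynomial.induction_on with
    | C a => simp [← MvPolynomial.algebraMap_eq]
    | add p q hp hq => rw [map_add, add_sub_add_comm]; exact I.add_mem hp hq
    | mul_X p i hp =>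
      rw [map_mul]
      exact I.sub_mem (I.mul_mem_left _ (hX i)) (I.mul_mem_left _ (hθX i))
  have hθI : ∀ q ∈ I, θ q ∈ I := fun q hq => by
    have := I.sub_mem hq (h0 q); simpa using this
  have h1 : ∀ q ∈ I, q - θ q ∈ I ^ 2 := by
    intro q hq
    induction hq using Submodule.span_induction with
    | mem x hx => obtain ⟨i, rfl⟩ := hx; exact hθ i
    | zero => simp
    | add x y _ _ hx hy => rw [map_add, add_sub_add_comm]; exact Ideal.add_mem _ hx hy
    | smul a x hx ih =>
      have : a • x - θ (a • x) = (a - θ a) * x + θ a * (x - θ x) := by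
        rw [smul_eq_mul, map_mul]; ring
      rw [this]
      refine Ideal.add_mem _ ?_ (Ideal.mul_mem_left _ _ ih)
      rw [pow_two]; exact Ideal.mul_mem_mul (h0 a) hx
  induction n with
  | zero => simpa using h0
  | succ n ih =>
    have key : ∀ q ∈ I ^ (n + 1), θ q ∈ I ^ (n + 1) ∧ q - θ q ∈ I ^ (n + 1 + 1) := by
      intro q hq
      rw [pow_succ] at hq
      induction hq using Submodule.mul_induction_on' with
      | mem_mul_mem a ha b hb =>
        rw [map_mul]
        refine ⟨by rw [pow_succ]; exact Ideal.mul_mem_mul (ih.1 a ha) (hθI b hb), ?_⟩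
        have : a * b - θ a * θ b = (a - θ a) * b + θ a * (b - θ b) := by ring
        rw [this]
        refine Ideal.add_mem _ ?_ ?_
        · rw [pow_succ]; exact Ideal.mul_mem_mul (ih.2 a ha) hb
        · rw [show n + 1 + 1 = n + 2 from rfl, pow_add]
          exact Ideal.mul_mem_mul (ih.1 a ha) (h1 b hb)
      | add x _ y _ hx hy =>
        rw [map_add, add_sub_add_comm]
        exact ⟨Ideal.add_mem _ hx.1 hy.1, Ideal.add_mem _ hx.2 hy.2⟩
    exact ⟨fun q hq => (key q hq).1, fun q hq => (key q hq).2⟩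

/-- If every variable is, up to second order, a polynomial in the `y i`, then so is every polynomial
up to any given order: each correction of order `D` is itself re-expanded by the same
substitution. -/
theorem exists_aeval_sub_mem_pow
    (y P : σ → MvPolynomial σ A)
    (hP : ∀ i, X i - aeval y (P i) ∈ idealOfVars σ A ^ 2) (D : ℕ) (q : MvPolynomial σ A) :
    ∃ Q : MvPolynomial σ A, q - aeval y Q ∈ idealOfVars σ A ^ D := by
  induction D with
  | zero => exact ⟨0, by simp⟩
  | succ D ih =>
    obtain ⟨Q, hQ⟩ := ih
    have := (sub_mem_pow_succ_of_sub_X_mem_sq ((aeval y).comp (aeval P))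
      (by simpa using hP) D).2 _ hQ
    refine ⟨Q + aeval P (q - aeval y Q), ?_⟩
    rw [map_add, ← sub_sub]
    exact this

/-- First order Taylor expansion at `a`, over any commutative ring. -/
theorem taylor_sub_mem_sq [Fintype σ] (a : σ → A) (f : MvPolynomial σ A) :
    aeval (fun i => C (a i) + X i) f - C (eval a f) - ∑ i, C (eval a (pderiv i f)) * X i
      ∈ idealOfVars σ A ^ 2 := by
  classical
  have hX : ∀ i, (X i : MvPolynomial σ A) ∈ idealOfVars σ A := fun i => Ideal.subset_span ⟨i, rfl⟩
  induction f using MvPolynomial.induction_on with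
  | C a => simp [MvPolynomial.algebraMap_eq]
  | add p q hp hq =>
    convert Ideal.add_mem _ hp hq using 1
    simp only [map_add, add_mul, Finset.sum_add_distrib]; ring
  | mul_X p j hp =>
    set T := ∑ i, C (eval a (pderiv i p)) * X i with hT
    have hTI : T ∈ idealOfVars σ A := Ideal.sum_mem _ fun i _ => Ideal.mul_mem_left _ _ (hX i)
    have h1 : ∑ i, C (eval a (pderiv i (p * X j))) * X i
        = T * C (a j) + C (eval a p) * (X j : MvPolynomial σ A) := by
      simp only [pderiv_mul, map_add, map_mul, eval_X, add_mul, Finset.sum_add_distrib, hT,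
        Finset.sum_mul]
      congr 1
      · exact Finset.sum_congr rfl fun i _ => by ring
      · rw [Finset.sum_eq_single j]
        · simp
        · intro i _ hij; rw [pderiv_X_of_ne hij.symm]; simp
        · simp
    rw [h1]
    have : aeval (fun i => C (a i) + X i) (p * X j) - C (eval a (p * X j))
          - (T * C (a j) + C (eval a p) * X j)
        = (aeval (fun i => C (a i) + X i) p - C (eval a p) - T) * (C (a j) + X j) + T * X j := by
      simp only [map_mul, aeval_X, eval_X]; ring
    rw [this]
    refine Ideal.add_mem _ (Ideal.mul_mem_right _ _ hp) ?_
    rw [pow_two]; exact Ideal.mul_mem_mul hTI (hX j)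

end Substitution

/-- Algebraic form of the implicit function theorem: where `∂f/∂x₂` is invertible, the displacement
`X 2` can be eliminated in favour of the increment of `f`, up to any given order. -/
theorem exists_translate_sub_mem_pow {A : Type*} [CommRing A] (a : Fin 3 → A)
    (f : MvPolynomial (Fin 3) A) (hf : IsUnit (eval a (pderiv 2 f))) (D : ℕ)
    (q : MvPolynomial (Fin 3) A) :
    ∃ Q : MvPolynomial (Fin 3) A, aeval (fun i => C (a i) + X i) q
      - aeval ![X 0, X 1, aeval (fun i => C (a i) + X i) f - C (eval a f)] Q
        ∈ idealOfVars (Fin 3) A ^ D := by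
  obtain ⟨e, he⟩ := hf.exists_left_inv
  refine exists_aeval_sub_mem_pow _
    ![X 0, X 1, C e * (X 2 - C (eval a (pderiv 0 f)) * X 0 - C (eval a (pderiv 1 f)) * X 1)]
    (fun i => ?_) D _
  have hg := taylor_sub_mem_sq a f
  -- for `i = 2` the given polynomial solves the linear part of the Taylor expansion for `X 2`
  fin_cases i
  · simp
  · simp
  · convert neg_mem (Ideal.mul_mem_left _ (C e) hg) using 1
    have hC : (C e * C (eval a (pderiv 2 f)) : MvPolynomial (Fin 3) A) = 1 := by
      rw [← C_mul, he, C_1]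
    simp only [Fin.sum_univ_three, Fin.reduceFinMk, Matrix.cons_val, map_mul, map_sub, aeval_X,
      algHom_C, MvPolynomial.algebraMap_eq]
    linear_combination (-X 2 : MvPolynomial (Fin 3) A) * hC

/-! ### Uniform local expansions -/

section UniformExpansion

variable {σ Λ : Type*} [TopologicalSpace Λ]

/-- Evaluation of a polynomial whose coefficients are continuous functions on a parameter space:
the coefficients are evaluated at the parameter `p`, the variables at `τ`. -/
noncomputable def evalAt (p : Λ) (τ : σ → ℝ) : MvPolynomial σ C(Λ, ℝ) →+* ℝ :=
  eval₂Hom (ContinuousMap.evalAlgHom ℝ ℝ p : C(Λ, ℝ) →+* ℝ) τ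

@[simp]
theorem evalAt_X (p : Λ) (τ : σ → ℝ) (i : σ) : evalAt p τ (X i) = τ i := by
  simp [evalAt]

@[simp]
theorem evalAt_C (p : Λ) (τ : σ → ℝ) (a : C(Λ, ℝ)) : evalAt p τ (C a) = a p := by
  simp [evalAt]

theorem evalAt_aeval {κ : Type*} (p : Λ) (τ : σ → ℝ) (y : κ → MvPolynomial σ C(Λ, ℝ))
    (P : MvPolynomial κ C(Λ, ℝ)) :
    evalAt p τ (aeval y P) = evalAt p (fun i => evalAt p τ (y i)) P := by
  induction P using MvPolynomial.induction_on with
  | C a => simp [MvPolynomial.algebraMap_eq]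
  | add p q hp hq => simp only [map_add, hp, hq]
  | mul_X p i hp => simp only [map_mul, hp, aeval_X, evalAt_X]

theorem evalAt_aeval_real {κ : Type*} (p : Λ) (τ : σ → ℝ) (y : κ → MvPolynomial σ C(Λ, ℝ))
    (P : MvPolynomial κ ℝ) :
    evalAt p τ (aeval y P) = eval (fun i => evalAt p τ (y i)) P := by
  induction P using MvPolynomial.induction_on with
  | C a => simp [MvPolynomial.algebraMap_apply]
  | add p q hp hq => simp [hp, hq]
  | mul_X p i hp => simp [hp]

theorem evalAt_eq_sum [Fintype σ] (p : Λ) (τ : σ → ℝ) (Q : MvPolynomial σ C(Λ, ℝ)) :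
    evalAt p τ Q = ∑ m ∈ Q.support, coeff m Q p * ∏ i, τ i ^ m i := by
  simp [evalAt, eval₂_eq']

/-- Terms of order `D` are `O(ρ ^ D)`, uniformly over a compact parameter space. -/
theorem exists_bound_of_mem_pow [Fintype σ] [CompactSpace Λ] {D : ℕ} {Q : MvPolynomial σ C(Λ, ℝ)}
    (hQ : Q ∈ idealOfVars σ C(Λ, ℝ) ^ D) :
    ∃ M : ℝ, 0 ≤ M ∧ ∀ (p : Λ) (ρ : ℝ) (τ : σ → ℝ), ρ ≤ 1 → (∀ i, |τ i| ≤ ρ) → 0 ≤ ρ →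
      |evalAt p τ Q| ≤ M * ρ ^ D := by
  refine ⟨∑ m ∈ Q.support, ‖coeff m Q‖, by positivity, fun p ρ τ hρ hτ hρ0 => ?_⟩
  rw [evalAt_eq_sum, Finset.sum_mul]
  refine (Finset.abs_sum_le_sum_abs _ _).trans (Finset.sum_le_sum fun m hm => ?_)
  rw [abs_mul, Finset.abs_prod]
  refine mul_le_mul ((coeff m Q).norm_coe_le_norm p) ?_ (by positivity) (by positivity)
  calc ∏ i, |τ i ^ m i| ≤ ∏ i, ρ ^ m i :=
        Finset.prod_le_prod (fun _ _ => abs_nonneg _) fun i _ => by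
          rw [abs_pow]; exact pow_le_pow_left₀ (abs_nonneg _) (hτ i) _
    _ = ρ ^ m.degree := by rw [Finset.prod_pow_eq_pow_sum, Finsupp.degree_eq_sum]
    _ ≤ ρ ^ D := pow_le_pow_of_le_one hρ0 hρ ((mem_pow_idealOfVars_iff D Q).1 hQ m hm)

end UniformExpansion

/-- The points of the cube `[-1,1]³` at which the last partial derivative of `f` has absolute value
at least `c`. They serve as the centres of the patches. -/
def centres (f : MvPolynomial (Fin 3) ℝ) (c : ℝ) : Set (Fin 3 → ℝ) :=
  {a | (∀ i, |a i| ≤ 1) ∧ c ≤ |eval a (pderiv 2 f)|}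

theorem isCompact_centres (f : MvPolynomial (Fin 3) ℝ) (c : ℝ) : IsCompact (centres f c) := by
  refine IsCompact.of_isClosed_subset
    (isCompact_univ_pi fun _ : Fin 3 => isCompact_Icc (a := (-1 : ℝ)) (b := 1)) ?_
    fun a ha i _ => abs_le.1 (ha.1 i)
  have h : centres f c
      = (⋂ i, {a | |a i| ≤ 1}) ∩ {a | c ≤ |eval a (pderiv 2 f)|} := by
    ext a; simp [centres]
  rw [h]
  refine IsClosed.inter (isClosed_iInter fun i => ?_) ?_
  · exact isClosed_le (by fun_prop) continuous_const
  · exact isClosed_le continuous_const (MvPolynomial.continuous_eval _).abs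

/-- The `i`-th coordinate of the centre, as a continuous function of the centre. -/
def centreCoord (f : MvPolynomial (Fin 3) ℝ) (c : ℝ) (i : Fin 3) : C(centres f c, ℝ) :=
  ⟨fun a => a.1 i, (continuous_apply i).comp continuous_subtype_val⟩

theorem eval_centreCoord (f : MvPolynomial (Fin 3) ℝ) (c : ℝ) (q : MvPolynomial (Fin 3) ℝ)
    (a : centres f c) :
    (eval (centreCoord f c) (map (algebraMap ℝ C(centres f c, ℝ)) q)) a = eval a.1 q := by
  induction q using MvPolynomial.induction_on with
  | C a => simp
  | add p q hp hq => simp only [map_add, ContinuousMap.add_apply, hp, hq]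
  | mul_X p i hp =>
    simp only [map_mul, ContinuousMap.mul_apply, hp, map_X, eval_X]
    rfl

/-- First order Taylor estimate for `f`, uniform in the centre. -/
theorem exists_linear_bound (f : MvPolynomial (Fin 3) ℝ) (c : ℝ) :
    ∃ M : ℝ, 0 ≤ M ∧ ∀ a ∈ centres f c, ∀ (ρ : ℝ) (τ : Fin 3 → ℝ), ρ ≤ 1 → (∀ i, |τ i| ≤ ρ) →
      |eval (a + τ) f - eval a f - ∑ i, eval a (pderiv i f) * τ i| ≤ M * ρ ^ 2 := by
  have := isCompact_iff_compactSpace.1 (isCompact_centres f c)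
  obtain ⟨M, hM, h⟩ := exists_bound_of_mem_pow
    (taylor_sub_mem_sq (centreCoord f c) (map (algebraMap ℝ C(centres f c, ℝ)) f))
  refine ⟨M, hM, fun a ha ρ τ hρ hτ => ?_⟩
  have := h ⟨a, ha⟩ ρ τ hρ hτ ((abs_nonneg _).trans (hτ 0))
  convert this using 2
  simp only [map_sub, map_sum, map_mul, aeval_map_algebraMap, evalAt_aeval_real, evalAt_C,
    evalAt_X, map_add, pderiv_map, eval_centreCoord]
  rfl

theorem exists_gradient_bound (f : MvPolynomial (Fin 3) ℝ) (c : ℝ) :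
    ∃ M : ℝ, 0 ≤ M ∧ ∀ a ∈ centres f c, ∀ i, |eval a (pderiv i f)| ≤ M := by
  have h (i : Fin 3) := (isCompact_centres f c).exists_bound_of_continuousOn
    (f := fun a => eval a (pderiv i f)) (MvPolynomial.continuous_eval _).continuousOn
  choose M hM using h
  refine ⟨∑ i, |M i|, by positivity, fun a ha i => (hM i a ha).trans ((le_abs_self _).trans ?_)⟩
  exact Finset.single_le_sum (f := fun i => |M i|) (fun _ _ => abs_nonneg _) (Finset.mem_univ i)

/-- Near a centre `a`, finitely many given polynomials are, up to `O(ρ ^ D)`, polynomials in the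
displacements `τ 0`, `τ 1` and the increment of `f`. The exponents that occur and the bounds for the
coefficients do not depend on `a`: `exists_translate_sub_mem_pow` is applied over the ring of
continuous functions on the compact set of centres. -/
theorem exists_expansion (f : MvPolynomial (Fin 3) ℝ) {c : ℝ} (hc : 0 < c) (D : ℕ)
    {ι : Type*} [Fintype ι] (q : ι → MvPolynomial (Fin 3) ℝ) :
    ∃ (T : Finset (Fin 3 →₀ ℕ)) (M : ℝ), 0 < M ∧ ∀ a ∈ centres f c,
      ∃ b : ι → (Fin 3 →₀ ℕ) → ℝ, (∀ i m, |b i m| ≤ M) ∧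
        ∀ (ρ : ℝ) (τ : Fin 3 → ℝ), ρ ≤ 1 → (∀ i, |τ i| ≤ ρ) → ∀ i,
          |eval (a + τ) (q i) - ∑ m ∈ T, b i m *
            (τ 0 ^ m 0 * τ 1 ^ m 1 * (eval (a + τ) f - eval a f) ^ m 2)| ≤ M * ρ ^ D := by
  classical
  have := isCompact_iff_compactSpace.1 (isCompact_centres f c)
  have hunit : IsUnit (eval (centreCoord f c)
      (pderiv 2 (map (algebraMap ℝ C(centres f c, ℝ)) f))) := by
    rw [ContinuousMap.isUnit_iff_forall_ne_zero]
    intro a h0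
    have := a.2.2
    rw [pderiv_map, eval_centreCoord] at h0
    rw [h0, abs_zero] at this
    linarith
  choose Q hQ using fun i => exists_translate_sub_mem_pow _ _ hunit D
    (map (algebraMap ℝ C(centres f c, ℝ)) (q i))
  choose M hM0 hM using fun i => exists_bound_of_mem_pow (hQ i)
  set T : Finset (Fin 3 →₀ ℕ) := Finset.univ.biUnion fun i => (Q i).support with hT
  have hTi : ∀ i, (Q i).support ⊆ T := fun i =>
    Finset.subset_biUnion_of_mem (fun i => (Q i).support) (Finset.mem_univ i)
  obtain ⟨N, hN⟩ : ∃ N : ℝ, ∀ i, ∀ m ∈ T, ‖coeff m (Q i)‖ ≤ N := by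
    refine ⟨∑ i, ∑ m ∈ T, ‖coeff m (Q i)‖, fun i m hm => ?_⟩
    have h2 := Finset.single_le_sum (f := fun m => ‖coeff m (Q i)‖)
      (fun _ _ => norm_nonneg _) hm
    have h3 := Finset.single_le_sum (f := fun i => ∑ m ∈ T, ‖coeff m (Q i)‖)
      (fun _ _ => Finset.sum_nonneg fun _ _ => norm_nonneg _) (Finset.mem_univ i)
    exact h2.trans h3
  have hMs : 0 ≤ ∑ i, M i := Finset.sum_nonneg fun i _ => hM0 i
  refine ⟨T, ∑ i, M i + |N| + 1, by positivity, fun a ha => ?_⟩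
  set p : centres f c := ⟨a, ha⟩ with hp
  refine ⟨fun i m => coeff m (Q i) p, fun i m => ?_, fun ρ τ hρ hτ i => ?_⟩
  · by_cases hm : m ∈ T
    · have h1 : |coeff m (Q i) p| ≤ _ := (coeff m (Q i)).norm_coe_le_norm p
      have h2 := hN i m hm
      have h3 := le_abs_self N
      linarith
    · have : coeff m (Q i) = 0 := notMem_support_iff.1 fun h => hm (hTi i h)
      simp only [this, ContinuousMap.zero_apply, abs_zero]
      positivity
  · have hρ0 := (abs_nonneg _).trans (hτ 0)
    have h1 := hM i p ρ τ hρ hτ hρ0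
    have h2 := Finset.single_le_sum (f := M) (fun i _ => hM0 i) (Finset.mem_univ i)
    refine le_trans (le_of_eq ?_) (h1.trans (mul_le_mul_of_nonneg_right
      (by linarith [abs_nonneg N]) (by positivity)))
    have hshift : ∀ h, evalAt p τ (aeval (fun i => C (centreCoord f c i) + X i)
        (map (algebraMap ℝ C(centres f c, ℝ)) h)) = eval (a + τ) h := fun h => by
      simp only [aeval_map_algebraMap, evalAt_aeval_real, evalAt_C, evalAt_X, map_add]
      rfl
    congr 1
    rw [map_sub, hshift, evalAt_aeval, evalAt_eq_sum]
    congr 1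
    symm
    refine (Finset.sum_subset (hTi i) fun m _ hm => ?_).trans (Finset.sum_congr rfl fun m _ => ?_)
    · simp [notMem_support_iff.1 hm]
    · simp only [Fin.prod_univ_three, Matrix.cons_val, evalAt_X, map_sub, hshift, evalAt_C,
        eval_centreCoord]
      rfl

/-- Two nearby points at which `f` takes almost the same value and whose first two coordinates are
within `ρ` are within `O(ρ)` of each other, because `∂f/∂x₂` is bounded away from zero. -/
theorem exists_patch_bound (f : MvPolynomial (Fin 3) ℝ) {c : ℝ} (hc : 0 < c) :
    ∃ η K : ℝ, 0 < η ∧ 1 ≤ K ∧ ∀ a ∈ centres f c, ∀ (ρ : ℝ) (τ : Fin 3 → ℝ),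
      (∀ i, |τ i| ≤ η) → |τ 0| ≤ ρ → |τ 1| ≤ ρ → |eval (a + τ) f - eval a f| ≤ 2 * ρ →
        ∀ i, |τ i| ≤ K * ρ := by
  obtain ⟨M, hM0, hM⟩ := exists_linear_bound f c
  obtain ⟨G, hG0, hG⟩ := exists_gradient_bound f c
  -- this choice of `η` makes the quadratic term at most `c / 2 * s`, where `s = ∑ |τ i|`
  refine ⟨min (1 / 3) (c / (6 * (M + 1))), 1 + 2 * (2 + 2 * G + c) / c, by positivity,
    by simp only [le_add_iff_nonneg_right]; positivity, fun a ha ρ τ hη h0 h1 hu => ?_⟩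
  have hρ : 0 ≤ ρ := (abs_nonneg _).trans h0
  have hη1 : ∀ i, |τ i| ≤ 1 / 3 := fun i => (hη i).trans (min_le_left _ _)
  have hη2 : ∀ i, |τ i| * (6 * (M + 1)) ≤ c := fun i =>
    (le_div_iff₀ (by positivity)).1 ((hη i).trans (min_le_right _ _))
  have hd : c ≤ |eval a (pderiv 2 f)| := ha.2
  set s := |τ 0| + |τ 1| + |τ 2| with hs
  have hs0 : 0 ≤ s := by positivity
  have hτs : ∀ i, |τ i| ≤ s := by
    intro i
    have := abs_nonneg (τ 0); have := abs_nonneg (τ 1); have := abs_nonneg (τ 2)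
    fin_cases i <;> simp only [hs, Fin.zero_eta, Fin.mk_one, Fin.reduceFinMk] <;> linarith
  have hlin := hM a ha s τ (by linarith [hη1 0, hη1 1, hη1 2]) hτs
  rw [Fin.sum_univ_three] at hlin
  have hMs : M * s ^ 2 ≤ c / 2 * s := by
    have : M * s ≤ c / 2 := by
      have h3 : s * (6 * (M + 1)) ≤ 3 * c := by
        rw [hs, add_mul, add_mul]; linarith [hη2 0, hη2 1, hη2 2]
      nlinarith
    nlinarith
  have hg0 : |eval a (pderiv 0 f) * τ 0| ≤ G * ρ := by
    rw [abs_mul]; exact mul_le_mul (hG a ha 0) h0 (abs_nonneg _) hG0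
  have hg1 : |eval a (pderiv 1 f) * τ 1| ≤ G * ρ := by
    rw [abs_mul]; exact mul_le_mul (hG a ha 1) h1 (abs_nonneg _) hG0
  have h2 : c * |τ 2| ≤ |eval a (pderiv 2 f) * τ 2| := by
    rw [abs_mul]; exact mul_le_mul_of_nonneg_right hd (abs_nonneg _)
  have h3 : |eval a (pderiv 2 f) * τ 2| ≤ 2 * ρ + G * ρ + G * ρ + c / 2 * s := by
    rw [abs_le] at hg0 hg1 hu hlin ⊢
    constructor <;> linarith [hg0.1, hg0.2, hg1.1, hg1.2, hu.1, hu.2, hlin.1, hlin.2]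
  have h4 : |τ 2| ≤ 2 * (2 + 2 * G + c) / c * ρ := by
    rw [div_mul_eq_mul_div, le_div_iff₀ hc]
    have : c / 2 * s ≤ c / 2 * (2 * ρ + |τ 2|) :=
      mul_le_mul_of_nonneg_left (by linarith) (by positivity)
    linarith
  have h5 : 0 ≤ 2 * (2 + 2 * G + c) / c * ρ := by positivity
  intro i
  fin_cases i <;> simp only [Fin.zero_eta, Fin.mk_one, Fin.reduceFinMk, add_mul, one_mul] <;>
    linarith

/-! ### The pigeonhole principle -/

/-- Siegel's lemma with real coefficients: if the number `(H + 1) ^ #ι` of integral vectors exceeds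
the number of boxes, two of them have their images in the same box, and their difference is a
non-zero vector on which the `m`-th linear form is at most the side `2 * S / n m` of the box. -/
theorem exists_small_combination {ι κ : Type*} [Fintype ι] (T : Finset κ) (b : ι → κ → ℝ)
    {M S : ℝ} (hb : ∀ i m, |b i m| ≤ M) (H : ℕ) (hS : 0 < S) (hMS : Fintype.card ι * M * H ≤ S)
    (n : κ → ℕ) (hn : ∀ m, 0 < n m) (hcard : ∏ m ∈ T, (n m + 1) < (H + 1) ^ Fintype.card ι) :
    ∃ A : ι → ℤ, A ≠ 0 ∧ (∀ i, |A i| ≤ H) ∧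
      ∀ m ∈ T, |∑ i, (A i : ℝ) * b i m| ≤ 2 * S / n m := by
  classical
  let v : (ι → Fin (H + 1)) → κ → ℝ := fun A m => ∑ i, (A i : ℝ) * b i m
  have hv : ∀ A m, |v A m| ≤ S := fun A m => by
    refine (Finset.abs_sum_le_sum_abs _ _).trans (le_trans ?_ hMS)
    have : ∑ i : ι, (H * M : ℝ) = Fintype.card ι * M * H := by
      rw [Finset.sum_const, Finset.card_univ, nsmul_eq_mul]; ring
    rw [← this]
    refine Finset.sum_le_sum fun i _ => ?_
    rw [abs_mul, Nat.abs_cast]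
    exact mul_le_mul (by exact_mod_cast Nat.lt_succ_iff.1 (A i).2) (hb i m) (abs_nonneg _)
      (by positivity)
  have hx : ∀ A m, 0 ≤ (v A m + S) * (n m / (2 * S)) := fun A m =>
    mul_nonneg (by linarith [(abs_le.1 (hv A m)).1]) (by positivity)
  let box : (ι → Fin (H + 1)) → (m : T) → Fin (n m + 1) := fun A m =>
    ⟨⌊(v A m + S) * (n m / (2 * S))⌋₊, Nat.lt_succ_of_le <| Nat.floor_le_of_le <| by
      calc (v A m + S) * (n m / (2 * S)) ≤ (2 * S) * (n m / (2 * S)) :=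
            mul_le_mul_of_nonneg_right (by linarith [(abs_le.1 (hv A m)).2]) (by positivity)
        _ = n m := by field_simp⟩
  obtain ⟨A, A', hne, heq⟩ := Fintype.exists_ne_map_eq_of_card_lt box (by
    rw [Fintype.card_pi, Fintype.card_fun, Fintype.card_fin]
    simp only [Fintype.card_fin]
    rw [Finset.prod_coe_sort T fun m => n m + 1]
    exact hcard)
  refine ⟨fun i => (A i : ℤ) - (A' i : ℤ), fun h0 => hne ?_, fun i => ?_, fun m hm => ?_⟩
  · ext i
    have := congrFun h0 i
    simp only [Pi.zero_apply] at this
    omega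
  · have := (A i).2; have := (A' i).2
    dsimp only
    rw [abs_le]; constructor <;> omega
  · have hbox : ⌊(v A m + S) * (n m / (2 * S))⌋₊ = ⌊(v A' m + S) * (n m / (2 * S))⌋₊ :=
      congrArg Fin.val (congrFun heq ⟨m, hm⟩)
    have h1 := Nat.floor_le (hx A m)
    have h2 := Nat.lt_floor_add_one ((v A m + S) * (n m / (2 * S)))
    have h3 := Nat.floor_le (hx A' m)
    have h4 := Nat.lt_floor_add_one ((v A' m + S) * (n m / (2 * S)))
    rw [hbox] at h1 h2
    have h5 : ∑ i, ((((A i : ℤ) - (A' i : ℤ) : ℤ)) : ℝ) * b i m = v A m - v A' m := by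
      simp only [v, ← Finset.sum_sub_distrib]
      exact Finset.sum_congr rfl fun i _ => by push_cast; ring
    have hnm : (0 : ℝ) < n m := by exact_mod_cast hn m
    have h6 : |(v A m - v A' m) * (n m / (2 * S))| ≤ 1 := by
      rw [abs_le]; constructor <;> linarith
    rw [h5, le_div_iff₀ hnm]
    rw [abs_mul, abs_of_pos (by positivity : (0 : ℝ) < n m / (2 * S)), ← mul_div_assoc,
      div_le_iff₀ (by positivity)] at h6
    linarith

/-! ### Counting weighted monomials -/

theorem add_pow_succ_ge {x c : ℝ} (hx : 0 ≤ x) (hc : 0 ≤ c) (j : ℕ) :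
    x ^ (j + 1) + (j + 1) * c * x ^ j ≤ (x + c) ^ (j + 1) := by
  induction j with
  | zero => simp
  | succ j ih =>
    have := mul_le_mul_of_nonneg_right ih (add_nonneg hx hc)
    rw [← pow_succ] at this
    refine le_trans ?_ this
    have h : 0 ≤ (j + 1) * c * x ^ j * c := by positivity
    push_cast
    linear_combination h

/-- Discrete analogue of integrating `(V - c * t) ^ j` over `0 ≤ t ≤ V / c`; the shift `V + c`
absorbs the difference between the sum and the integral. -/
theorem sum_posPart_pow_le {c : ℝ} (hc : 0 < c) (V : ℝ) {j : ℕ} (hj : j ≠ 0) (L : ℕ) :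
    ∑ n ∈ Finset.range L, (max (V - c * n) 0) ^ j
      ≤ (max (V + c) 0) ^ (j + 1) / ((j + 1) * c) := by
  have hjc : 0 < (j + 1) * c := by positivity
  have step : ∀ n : ℕ, (max (V - c * n) 0) ^ j * ((j + 1) * c)
      ≤ (max (V + c - c * n) 0) ^ (j + 1) - (max (V + c - c * (n + 1 : ℕ)) 0) ^ (j + 1) := by
    intro n
    have h1 : V + c - c * (n + 1 : ℕ) = V - c * n := by push_cast; ring
    rw [h1]
    rcases le_total 0 (V - c * n) with h | h
    · rw [max_eq_left h, max_eq_left (by linarith)]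
      have := add_pow_succ_ge h hc.le j
      rw [show V + c - c * n = V - c * n + c by ring]
      linarith
    · rw [max_eq_right h, zero_pow hj, zero_pow j.succ_ne_zero]
      simp only [zero_mul, sub_zero]
      positivity
  rw [le_div_iff₀ hjc, Finset.sum_mul]
  refine (Finset.sum_le_sum fun n _ => step n).trans ?_
  rw [Finset.sum_range_sub']
  simp only [Nat.cast_zero, mul_zero, sub_zero]
  have : (0 : ℝ) ≤ (max (V + c - c * L) 0) ^ (j + 1) := by positivity
  linarith

/-- The total defect `∑ (W - w m)₊` for the weights `w m = r * (m 0 + m 1) + k * m 2`, summed one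
variable at a time. The bound is independent of the finite set of exponents. -/
theorem sum_weight_le {r k W : ℝ} (hr : 0 < r) (hk : 0 < k) (hW : 0 ≤ W)
    (T : Finset (Fin 3 →₀ ℕ)) :
    ∑ m ∈ T, max (W - (r * (m 0 + m 1) + k * m 2)) 0 ≤ (W + 2 * r + k) ^ 4 / (24 * r ^ 2 * k) := by
  classical
  set L := T.sup (fun m => m 0 + m 1 + m 2) + 1 with hL
  let e : (Fin 3 →₀ ℕ) → ℕ × ℕ × ℕ := fun m => (m 0, m 1, m 2)
  have he : Set.InjOn e T := by
    intro m _ m' _ h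
    simp only [e, Prod.mk.injEq] at h
    ext i
    fin_cases i
    exacts [h.1, h.2.1, h.2.2]
  let φ : ℕ × ℕ × ℕ → ℝ := fun x => max (W - (r * (x.1 + x.2.1) + k * x.2.2)) 0
  have hsub : T.image e ⊆ Finset.range L ×ˢ Finset.range L ×ˢ Finset.range L := by
    intro x hx
    obtain ⟨m, hm, rfl⟩ := Finset.mem_image.1 hx
    have := Finset.le_sup (f := fun m : Fin 3 →₀ ℕ => m 0 + m 1 + m 2) hm
    simp only [Finset.mem_product, Finset.mem_range, e]
    omega
  calc ∑ m ∈ T, max (W - (r * (m 0 + m 1) + k * m 2)) 0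
      = ∑ x ∈ T.image e, φ x := by rw [Finset.sum_image he]
    _ ≤ ∑ x ∈ Finset.range L ×ˢ Finset.range L ×ˢ Finset.range L, φ x :=
        Finset.sum_le_sum_of_subset_of_nonneg hsub fun _ _ _ => le_max_right _ _
    _ = ∑ x ∈ Finset.range L, ∑ y ∈ Finset.range L, ∑ z ∈ Finset.range L,
          (max (W - r * x - r * y - k * z) 0) ^ 1 := by
        simp only [Finset.sum_product, φ, pow_one]
        refine Finset.sum_congr rfl fun x _ => Finset.sum_congr rfl fun y _ =>
          Finset.sum_congr rfl fun z _ => ?_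
        congr 1; ring
    _ ≤ ∑ x ∈ Finset.range L, ∑ y ∈ Finset.range L,
          (max (W + k - r * x - r * y) 0) ^ 2 / (2 * k) := by
        refine Finset.sum_le_sum fun x _ => Finset.sum_le_sum fun y _ => ?_
        refine (sum_posPart_pow_le hk _ one_ne_zero L).trans (le_of_eq ?_)
        rw [show W - r * x - r * y + k = W + k - r * x - r * y by ring]
        norm_num
    _ ≤ ∑ x ∈ Finset.range L, (max (W + k + r - r * x) 0) ^ 3 / (3 * r) / (2 * k) := by
        refine Finset.sum_le_sum fun x _ => ?_
        rw [← Finset.sum_div]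
        refine div_le_div_of_nonneg_right ?_ (by positivity)
        refine (sum_posPart_pow_le hr _ two_ne_zero L).trans (le_of_eq ?_)
        rw [show W + k - r * x + r = W + k + r - r * x by ring]
        norm_num
    _ ≤ (max (W + k + r + r) 0) ^ 4 / (4 * r) / (3 * r) / (2 * k) := by
        rw [← Finset.sum_div, ← Finset.sum_div]
        refine div_le_div_of_nonneg_right (div_le_div_of_nonneg_right ?_ (by positivity))
          (by positivity)
        refine (sum_posPart_pow_le hr _ three_ne_zero L).trans (le_of_eq ?_)
        norm_num
    _ = (W + 2 * r + k) ^ 4 / (24 * r ^ 2 * k) := by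
        rw [max_eq_left (by positivity)]
        field_simp
        ring

/-- The exponents of the monomials of degree `δ` in four variables. -/
abbrev FormExponent (δ : ℕ) : Type :=
  Finset.finsuppAntidiag (Finset.univ : Finset (Fin 4)) δ

theorem card_formExponent (δ : ℕ) : (δ : ℝ) ^ 3 / 6 ≤ Fintype.card (FormExponent δ) := by
  have h : Fintype.card (FormExponent δ) = (δ + 3).choose 3 := by
    rw [Fintype.card_coe, Finset.card_finsuppAntidiag_nat_eq_choose, Finset.card_univ,
      Fintype.card_fin, show 4 + δ - 1 = δ + 3 by omega, Nat.choose_symm_add]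
  have h2 : (δ + 1) * (δ + 2) * (δ + 3) = 6 * (δ + 3).choose 3 := by
    have := Nat.descFactorial_eq_factorial_mul_choose (δ + 3) 3
    simp only [Nat.descFactorial, Nat.factorial] at this
    have e1 : δ + 3 - 0 = δ + 3 := rfl
    have e2 : δ + 3 - 1 = δ + 2 := rfl
    have e3 : δ + 3 - 2 = δ + 1 := rfl
    rw [e1, e2, e3] at this
    linarith
  have h3 : ((δ : ℝ) + 1) * (δ + 2) * (δ + 3) = 6 * ((δ + 3).choose 3 : ℕ) := by
    exact_mod_cast h2
  rw [h, div_le_iff₀ (by norm_num)]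
  have : (0 : ℝ) ≤ δ := by positivity
  nlinarith [sq_nonneg (δ : ℝ)]

/-- With `W = 4 / 3 * δ` the leading terms in `δ` of the two sides are
`(4 / 3) ^ 4 / (24 * r ^ 2 * k) * δ ^ 4` and `δ ^ 4 / 18`; the condition `64 / 27 < r ^ 2 * k` is exactly
what makes the former smaller. The ratio `4 / 3` is the optimal one. -/
theorem exists_degree {r k : ℝ} (hr : 0 < r) (hk : 0 < k) (h : 64 / 27 < r ^ 2 * k) :
    ∃ δ : ℕ, 0 < δ ∧ ((4 / 3 * δ : ℝ) + 2 * r + k) ^ 4 / (24 * r ^ 2 * k)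
      < Fintype.card (FormExponent δ) * (4 / 3 * δ - δ : ℝ) := by
  have hlim : Filter.Tendsto (fun δ : ℕ => (4 / 3 + (2 * r + k) / (δ : ℝ)) ^ 4) Filter.atTop
      (nhds ((4 / 3 + 0) ^ 4)) :=
    ((tendsto_const_div_atTop_nhds_zero_nat (2 * r + k)).const_add _).pow 4
  have hlt : ((4 / 3 + 0) ^ 4 : ℝ) < 4 / 3 * (r ^ 2 * k) := by linarith
  obtain ⟨δ, hδ, hδ0⟩ := ((hlim.eventually (gt_mem_nhds hlt)).and
    (Filter.eventually_gt_atTop 0)).exists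
  refine ⟨δ, hδ0, ?_⟩
  have hδ' : (0 : ℝ) < δ := by exact_mod_cast hδ0
  have h1 : (4 / 3 * δ : ℝ) + 2 * r + k = δ * (4 / 3 + (2 * r + k) / δ) := by
    field_simp
    ring
  have h2 := card_formExponent δ
  calc ((4 / 3 * δ : ℝ) + 2 * r + k) ^ 4 / (24 * r ^ 2 * k)
      = δ ^ 4 * (4 / 3 + (2 * r + k) / δ) ^ 4 / (24 * r ^ 2 * k) := by rw [h1, mul_pow]
    _ < δ ^ 4 * (4 / 3 * (r ^ 2 * k)) / (24 * r ^ 2 * k) := by gcongr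
    _ = δ ^ 3 / 6 * (4 / 3 * δ - δ : ℝ) := by field_simp; ring
    _ ≤ _ := by
      refine mul_le_mul_of_nonneg_right h2 (by linarith)

/-! ### Dehomogenization and forms -/

/-- The dehomogenization of a form in four variables with respect to the last one. -/
noncomputable def dehom (F : MvPolynomial (Fin 4) ℤ) : MvPolynomial (Fin 3) ℝ :=
  aeval ![X 0, X 1, X 2, 1] F

/-- The affine coordinates `(x₀/x₃, x₁/x₃, x₂/x₃)` of an integral point, meaningful for
`x 3 ≠ 0`. -/
noncomputable def ratio (x : Fin 4 → ℤ) : Fin 3 → ℝ := fun i => x i.castSucc / x 3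

theorem eval_dehom (F : MvPolynomial (Fin 4) ℤ) (t : Fin 3 → ℝ) :
    eval t (dehom F) = aeval ![t 0, t 1, t 2, 1] F := by
  induction F using MvPolynomial.induction_on with
  | C a => simp [dehom]
  | add p q hp hq => simp only [dehom, map_add] at *; rw [hp, hq]
  | mul_X p i hp =>
    simp only [dehom, map_mul, aeval_X] at *
    rw [hp]
    congr 1
    fin_cases i <;> simp

theorem pderiv_two_dehom (F : MvPolynomial (Fin 4) ℤ) :
    pderiv 2 (dehom F) = dehom (pderiv 2 F) := by
  induction F using MvPolynomial.induction_on with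
  | C a => simp [dehom]
  | add p q hp hq => simp only [dehom, map_add] at *; rw [hp, hq]
  | mul_X p i hp =>
    simp only [dehom, map_mul, aeval_X, pderiv_mul, map_add] at *
    rw [hp]
    congr 2
    fin_cases i <;> simp [pderiv_X]

theorem aeval_smul_of_isHomogeneous {F : MvPolynomial (Fin 4) ℤ} {n : ℕ} (hF : F.IsHomogeneous n)
    (c : ℝ) (z : Fin 4 → ℝ) : aeval (fun i => c * z i) F = c ^ n * aeval z F := by
  rw [aeval_def, aeval_def, eval₂_eq', eval₂_eq', Finset.mul_sum]
  refine Finset.sum_congr rfl fun m hm => ?_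
  have hn : n = ∑ i, m i := by
    rw [hF.degree_eq_sum_deg_support hm]
    exact Finset.sum_subset (Finset.subset_univ _) fun i _ hi => Finsupp.notMem_support_iff.1 hi
  rw [hn, ← Finset.prod_pow_eq_pow_sum]
  simp only [mul_pow, Finset.prod_mul_distrib]
  ring

theorem intCast_eval (F : MvPolynomial (Fin 4) ℤ) (x : Fin 4 → ℤ) :
    ((eval x F : ℤ) : ℝ) = aeval (fun i => (x i : ℝ)) F := by
  induction F using MvPolynomial.induction_on with
  | C a => simp
  | add p q hp hq => rw [map_add, map_add, Int.cast_add, hp, hq]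
  | mul_X p i hp => rw [map_mul, map_mul, Int.cast_mul, hp, eval_X, aeval_X]

theorem eval_eq_pow_mul_eval_ratio {F : MvPolynomial (Fin 4) ℤ} {n : ℕ} (hF : F.IsHomogeneous n)
    {x : Fin 4 → ℤ} (hx : x 3 ≠ 0) :
    ((eval x F : ℤ) : ℝ) = (x 3 : ℝ) ^ n * eval (ratio x) (dehom F) := by
  have hx' : (x 3 : ℝ) ≠ 0 := by exact_mod_cast hx
  rw [eval_dehom, ← aeval_smul_of_isHomogeneous hF]
  have h : (fun i => (x 3 : ℝ) * ![ratio x 0, ratio x 1, ratio x 2, 1] i) = fun i => (x i : ℝ) := by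
    ext i
    fin_cases i <;> simp [ratio] <;> field_simp
  rw [h, intCast_eval]

/-- The form of degree `δ` with the given coefficients. -/
noncomputable def formOfCoeffs {δ : ℕ} (A : FormExponent δ → ℤ) : MvPolynomial (Fin 4) ℤ :=
  ∑ i, monomial i.1 (A i)

theorem formOfCoeffs_isHomogeneous {δ : ℕ} (A : FormExponent δ → ℤ) :
    (formOfCoeffs A).IsHomogeneous δ := by
  refine IsHomogeneous.sum _ _ _ fun i _ => isHomogeneous_monomial _ ?_
  rw [Finsupp.degree_eq_sum]
  exact (Finset.mem_finsuppAntidiag.1 i.2).1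

theorem formOfCoeffs_ne_zero {δ : ℕ} {A : FormExponent δ → ℤ} (hA : A ≠ 0) :
    formOfCoeffs A ≠ 0 := by
  classical
  obtain ⟨i, hi⟩ := Function.ne_iff.1 hA
  intro h
  apply hi
  have := congrArg (coeff i.1) h
  simpa [formOfCoeffs, coeff_sum, coeff_monomial, Subtype.ext_iff.symm] using this

theorem eval_dehom_formOfCoeffs {δ : ℕ} (A : FormExponent δ → ℤ) (t : Fin 3 → ℝ) :
    eval t (dehom (formOfCoeffs A)) = ∑ i, (A i : ℝ) * eval t (dehom (monomial i.1 1)) := by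
  simp only [eval_dehom, formOfCoeffs, map_sum]
  refine Finset.sum_congr rfl fun i _ => ?_
  simp [aeval_monomial]

/-! ### An auxiliary form on a patch -/

/-- The number of boxes is `O(R ^ ∑ v m)`, the number of coefficient vectors at least
`R ^ (s * h)`. -/
theorem eventually_prod_boxes_lt {κ : Type*} (T : Finset κ) {v : κ → ℝ} (hv : ∀ m, 0 ≤ v m)
    {Θ h : ℝ} (hΘ : 0 ≤ Θ) {s : ℕ} (hs : ∑ m ∈ T, v m < s * h) :
    ∀ᶠ R : ℝ in Filter.atTop, ∏ m ∈ T, (⌈Θ * R ^ v m⌉₊ + 1) < (⌊R ^ h⌋₊ + 1) ^ s := by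
  have hE : 0 < s * h - ∑ m ∈ T, v m := by linarith
  filter_upwards [(tendsto_rpow_atTop hE).eventually_gt_atTop ((Θ + 2) ^ T.card),
    Filter.eventually_ge_atTop 1] with R hR hR1
  have hR0 : 0 < R := by linarith
  have h1 : ∀ m ∈ T, ((⌈Θ * R ^ v m⌉₊ : ℝ) + 1) ≤ (Θ + 2) * R ^ v m := fun m _ => by
    have h2 := Nat.ceil_lt_add_one (show 0 ≤ Θ * R ^ v m by positivity)
    have h3 : 1 ≤ R ^ v m := Real.one_le_rpow hR1 (hv m)
    linarith
  have h4 : (∏ m ∈ T, ((⌈Θ * R ^ v m⌉₊ : ℝ) + 1)) < ((⌊R ^ h⌋₊ : ℝ) + 1) ^ s := by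
    calc ∏ m ∈ T, ((⌈Θ * R ^ v m⌉₊ : ℝ) + 1) ≤ ∏ m ∈ T, (Θ + 2) * R ^ v m :=
          Finset.prod_le_prod (fun _ _ => by positivity) h1
      _ = (Θ + 2) ^ T.card * R ^ (∑ m ∈ T, v m) := by
          rw [Finset.prod_mul_distrib, Finset.prod_const, Real.rpow_sum_of_pos hR0]
      _ < R ^ (s * h - ∑ m ∈ T, v m) * R ^ (∑ m ∈ T, v m) := by gcongr
      _ = (R ^ h) ^ s := by
          rw [← Real.rpow_add hR0, ← Real.rpow_natCast, ← Real.rpow_mul hR0.le]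
          congr 1; ring
      _ ≤ _ := by
          have := (Nat.lt_floor_add_one (R ^ h)).le
          gcongr
  exact_mod_cast h4

/-- A linear combination of the `q i` is small if each `q i` has an expansion in the `y m` and the
coefficients of the combined expansion are small wherever `y m` is not. -/
theorem abs_sum_mul_le_of_expansion {ι κ : Type*} [Fintype ι] {T : Finset κ} {A q : ι → ℝ}
    {b : ι → κ → ℝ} {y : κ → ℝ} {H e β : ℝ} (hH : 0 ≤ H) (hA : ∀ i, |A i| ≤ H)
    (hq : ∀ i, |q i - ∑ m ∈ T, b i m * y m| ≤ e)
    (hβ : ∀ m ∈ T, |∑ i, A i * b i m| * |y m| ≤ β) :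
    |∑ i, A i * q i| ≤ Fintype.card ι * (H * e) + T.card * β := by
  have h : ∑ i, A i * q i = ∑ i, A i * (q i - ∑ m ∈ T, b i m * y m)
      + ∑ m ∈ T, (∑ i, A i * b i m) * y m := by
    simp only [mul_sub, Finset.sum_sub_distrib, Finset.mul_sum, Finset.sum_mul]
    rw [Finset.sum_comm (s := T)]
    simp only [mul_assoc, sub_add_cancel]
  rw [h]
  refine (abs_add_le _ _).trans (add_le_add ?_ ?_)
  · refine (Finset.abs_sum_le_sum_abs _ _).trans ?_
    rw [← nsmul_eq_mul]
    refine Finset.sum_le_card_nsmul _ _ _ fun i _ => ?_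
    rw [abs_mul]
    exact mul_le_mul (hA i) (hq i) (abs_nonneg _) hH
  · refine (Finset.abs_sum_le_sum_abs _ _).trans ?_
    rw [← nsmul_eq_mul]
    refine Finset.sum_le_card_nsmul _ _ _ fun m hm => ?_
    rw [abs_mul]
    exact hβ m hm

theorem abs_monomial_le {K U R r : ℝ} {k : ℕ} (hR : 0 < R) (hK : 0 ≤ K) {t₀ t₁ u : ℝ}
    (h0 : |t₀| ≤ K * R ^ (-r)) (h1 : |t₁| ≤ K * R ^ (-r)) (hu : |u| ≤ U * R ^ (-k : ℝ))
    (a b c : ℕ) :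
    |t₀ ^ a * t₁ ^ b * u ^ c| ≤ K ^ (a + b) * U ^ c * R ^ (-(r * (a + b) + k * c)) := by
  have hRk : (R ^ (-k : ℝ)) ^ c = R ^ (-(k * c) : ℝ) := by
    rw [← Real.rpow_natCast, ← Real.rpow_mul hR.le]; congr 1; ring
  have hRr : (R ^ (-r)) ^ (a + b) = R ^ (-(r * (a + b))) := by
    rw [← Real.rpow_natCast, ← Real.rpow_mul hR.le]; congr 1; push_cast; ring
  have hKρ : 0 ≤ K * R ^ (-r) := by positivity
  calc |t₀ ^ a * t₁ ^ b * u ^ c| = |t₀| ^ a * |t₁| ^ b * |u| ^ c := by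
        rw [abs_mul, abs_mul, abs_pow, abs_pow, abs_pow]
    _ ≤ (K * R ^ (-r)) ^ a * (K * R ^ (-r)) ^ b * (U * R ^ (-k : ℝ)) ^ c := by
        gcongr
    _ = K ^ (a + b) * U ^ c * R ^ (-(r * (a + b) + k * c)) := by
        rw [← pow_add, mul_pow, mul_pow, hRk, hRr, neg_add, Real.rpow_add hR]
        ring

/-- The integral points over a patch of radius `O(R ^ (-r))`, at which `f` differs from its value at
the centre by `O(R ^ (-k))`, are zeros of a single form of degree `δ`. Its coefficients have size at
most `R ^ (W - δ)`, and are chosen so that the form is less than `1` in absolute value at these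
points. -/
theorem exists_form_on_patch (f : MvPolynomial (Fin 3) ℝ) {c : ℝ} (hc : 0 < c)
    {r : ℝ} (hr : 0 < r) {k : ℕ} (hk : 0 < k) {δ : ℕ} {W : ℝ} (hδW : (δ : ℝ) ≤ W)
    (hW : (W + 2 * r + k) ^ 4 / (24 * r ^ 2 * k) < Fintype.card (FormExponent δ) * (W - δ))
    {K U : ℝ} (hK : 0 < K) (hU : 0 ≤ U) :
    ∃ R₀ : ℝ, 1 ≤ R₀ ∧ ∀ R, R₀ ≤ R → ∀ a ∈ centres f c,
      ∃ A : MvPolynomial (Fin 4) ℤ, (A ≠ 0 ∧ A.IsHomogeneous δ) ∧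
        ∀ x : Fin 4 → ℤ, x 3 ≠ 0 → |(x 3 : ℝ)| ≤ R →
          (∀ i, |ratio x i - a i| ≤ K * R ^ (-r)) →
          |eval (ratio x) f - eval a f| ≤ U * R ^ (-k : ℝ) → eval x A = 0 := by
  -- `D` makes the remainder `R ^ W * (R ^ (-r)) ^ D` at most `R⁻¹`
  obtain ⟨D, hD⟩ := exists_nat_gt ((W + 1) / r)
  rw [div_lt_iff₀ hr] at hD
  obtain ⟨T, M, hM, hT⟩ := exists_expansion f hc D
    (fun i : FormExponent δ => dehom (monomial i.1 1))
  obtain ⟨s, hs⟩ : ∃ s : ℝ, s = Fintype.card (FormExponent δ) := ⟨_, rfl⟩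
  have hs0 : 0 ≤ s := hs ▸ Nat.cast_nonneg _
  obtain ⟨C₁, hC₁, hC₁m⟩ : ∃ C₁ : ℝ, 0 < C₁ ∧ ∀ m ∈ T, K ^ (m 0 + m 1) * U ^ m 2 ≤ C₁ := by
    refine ⟨1 + ∑ m ∈ T, K ^ (m 0 + m 1) * U ^ m 2, by positivity, fun m hm => ?_⟩
    exact (Finset.single_le_sum (f := fun m : Fin 3 →₀ ℕ => K ^ (m 0 + m 1) * U ^ m 2)
      (fun _ _ => by positivity) hm).trans (by linarith)
  obtain ⟨w, hw⟩ : ∃ w : (Fin 3 →₀ ℕ) → ℝ, ∀ m, w m = r * (m 0 + m 1) + k * m 2 :=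
    ⟨_, fun _ => rfl⟩
  obtain ⟨Θ, hΘ⟩ : ∃ Θ : ℝ, Θ = 8 * (s + 1) * M * C₁ * (T.card + 1) := ⟨_, rfl⟩
  have hΘ0 : 0 < Θ := by rw [hΘ]; positivity
  have hsum : ∑ m ∈ T, max (W - w m) 0 < Fintype.card (FormExponent δ) * (W - δ) := by
    simp only [hw]
    exact (sum_weight_le hr (by exact_mod_cast hk) ((Nat.cast_nonneg δ).trans hδW) T).trans_lt hW
  obtain ⟨R₀, hR₀⟩ := Filter.eventually_atTop.1
    ((eventually_prod_boxes_lt T (fun _ => le_max_right _ _) hΘ0.le hsum).and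
      (((tendsto_rpow_atTop hr).eventually_ge_atTop K).and
        (Filter.eventually_gt_atTop (4 * s * M * K ^ D))))
  refine ⟨max R₀ 1, le_max_right _ _, fun R hR a ha => ?_⟩
  obtain ⟨hcard, hKR, hRD⟩ := hR₀ R ((le_max_left _ _).trans hR)
  have hR1 : 1 ≤ R := (le_max_right _ _).trans hR
  have hR0 : 0 < R := by linarith
  obtain ⟨b, hbM, hb⟩ := hT a ha
  have hHle : (⌊R ^ (W - δ)⌋₊ : ℝ) ≤ R ^ (W - δ) := Nat.floor_le (by positivity)
  obtain ⟨S, hS⟩ : ∃ S : ℝ, S = (s + 1) * M * R ^ (W - δ) := ⟨_, rfl⟩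
  have hMS : s * M * ⌊R ^ (W - δ)⌋₊ ≤ S := by
    have : s * M * ⌊R ^ (W - δ)⌋₊ ≤ s * M * R ^ (W - δ) := by gcongr
    have h2 : 0 < M * R ^ (W - δ) := by positivity
    rw [hS]; linarith
  have hS0 : 0 < S := by rw [hS]; positivity
  -- the number of boxes balances `R ^ δ * R ^ (W - δ)` against the size `R ^ (-w m)` of the
  -- monomial
  obtain ⟨A, hA0, hAH, hA⟩ := exists_small_combination T b hbM _ hS0 (hs ▸ hMS)
    (fun m => ⌈Θ * R ^ max (W - w m) 0⌉₊) (fun m => Nat.ceil_pos.2 (by positivity)) hcard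
  refine ⟨formOfCoeffs A, ⟨formOfCoeffs_ne_zero hA0, formOfCoeffs_isHomogeneous A⟩,
    fun x hx hxR hτ hu => ?_⟩
  have hρ0 : 0 < R ^ (-r) := by positivity
  have hKρ : K * R ^ (-r) ≤ 1 := by
    rw [Real.rpow_neg hR0.le, ← div_eq_mul_inv, div_le_one (by positivity)]
    exact hKR
  have hexp := hb (K * R ^ (-r)) (ratio x - a) hKρ hτ
  rw [add_sub_cancel] at hexp
  have hterm : ∀ m ∈ T, |∑ i, (A i : ℝ) * b i m| * |(ratio x - a) 0 ^ m 0 * (ratio x - a) 1 ^ m 1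
      * (eval (ratio x) f - eval a f) ^ m 2| ≤ R ^ (-δ : ℝ) / (4 * (T.card + 1)) := fun m hm => by
    have h1 : Θ * R ^ (W - w m) ≤ ⌈Θ * R ^ max (W - w m) 0⌉₊ :=
      le_trans (mul_le_mul_of_nonneg_left (Real.rpow_le_rpow_of_exponent_le hR1 (le_max_left _ _))
        hΘ0.le) (Nat.le_ceil _)
    have h2 := abs_monomial_le hR0 hK.le (hτ 0) (hτ 1) hu (m 0) (m 1) (m 2)
    rw [← hw] at h2
    have h3 : 0 < Θ * R ^ (W - w m) := by positivity
    calc _ ≤ 2 * S / ⌈Θ * R ^ max (W - w m) 0⌉₊ * (C₁ * R ^ (-w m)) :=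
          mul_le_mul (hA m hm) (h2.trans (mul_le_mul_of_nonneg_right (hC₁m m hm)
            (by positivity))) (abs_nonneg _) (by positivity)
      _ ≤ 2 * S / (Θ * R ^ (W - w m)) * (C₁ * R ^ (-w m)) := by gcongr
      _ = R ^ (-δ : ℝ) / (4 * (T.card + 1)) := by
          have e1 : R ^ (W - δ) * R ^ (-w m) = R ^ (W - w m) * R ^ (-δ : ℝ) := by
            rw [← Real.rpow_add hR0, ← Real.rpow_add hR0]; congr 1; ring
          have e2 : 2 * S / (Θ * R ^ (W - w m)) * (C₁ * R ^ (-w m))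
              = 2 * (s + 1) * M * C₁ / (Θ * R ^ (W - w m)) * (R ^ (W - δ) * R ^ (-w m)) := by
            rw [hS]; ring
          have hne : R ^ (W - w m) ≠ 0 := by positivity
          rw [e2, e1, hΘ]
          field_simp
          norm_num
  have hval := abs_sum_mul_le_of_expansion (show 0 ≤ R ^ (W - δ) by positivity)
    (A := fun i => (A i : ℝ)) (fun i => le_trans (by exact_mod_cast hAH i) hHle) hexp hterm
  rw [← eval_dehom_formOfCoeffs, ← hs] at hval
  have hmain : T.card * (R ^ (-δ : ℝ) / (4 * (T.card + 1))) ≤ 1 / 4 * R ^ (-δ : ℝ) := by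
    rw [mul_div_assoc', div_le_iff₀ (by positivity)]
    have : 0 < R ^ (-δ : ℝ) := by positivity
    linarith
  have hrest : s * (R ^ (W - δ) * (M * (K * R ^ (-r)) ^ D)) ≤ 1 / 4 * R ^ (-δ : ℝ) := by
    have hρD : (R ^ (-r)) ^ D ≤ R ^ (-W - 1) := by
      rw [← Real.rpow_natCast, ← Real.rpow_mul hR0.le]
      exact Real.rpow_le_rpow_of_exponent_le hR1 (by linarith)
    calc _ = s * M * K ^ D * R ^ (W - δ) * (R ^ (-r)) ^ D := by rw [mul_pow]; ring
      _ ≤ s * M * K ^ D * R ^ (W - δ) * R ^ (-W - 1) := by gcongr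
      _ = s * M * K ^ D * R⁻¹ * R ^ (-δ : ℝ) := by
          rw [mul_assoc, ← Real.rpow_add hR0, mul_assoc _ R⁻¹, ← Real.rpow_neg_one R,
            ← Real.rpow_add hR0]
          congr 2; ring
      _ ≤ 1 / 4 * R ^ (-δ : ℝ) := by
          refine mul_le_mul_of_nonneg_right ?_ (by positivity)
          rw [← div_eq_mul_inv, div_le_iff₀ hR0]
          linarith
  have hlt : |((eval x (formOfCoeffs A) : ℤ) : ℝ)| < 1 := by
    rw [eval_eq_pow_mul_eval_ratio (formOfCoeffs_isHomogeneous A) hx, abs_mul, abs_pow]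
    calc |(x 3 : ℝ)| ^ δ * |eval (ratio x) (dehom (formOfCoeffs A))|
        ≤ R ^ δ * (1 / 2 * R ^ (-δ : ℝ)) :=
          mul_le_mul (pow_le_pow_left₀ (abs_nonneg _) hxR _) (by linarith) (abs_nonneg _)
            (by positivity)
      _ = 1 / 2 := by
          rw [Real.rpow_neg hR0.le, Real.rpow_natCast]
          field_simp
      _ < 1 := by norm_num
  exact Int.abs_lt_one_iff.1 (by exact_mod_cast hlt)

/-! ### Covering a dyadic shell by patches -/

theorem floor_div_mem_Icc {t e : ℝ} (he : 0 < e) (ht : |t| ≤ 1) :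
    ⌊t / e⌋ ∈ Finset.Icc (-(⌈1 / e⌉₊ : ℤ)) ⌈1 / e⌉₊ := by
  have h := abs_le.1 ht
  have hc : 1 / e ≤ (⌈1 / e⌉₊ : ℝ) := Nat.le_ceil _
  have h1 : t / e ≤ 1 / e := by gcongr; exact h.2
  have h2 : -(1 / e) ≤ t / e := by rw [← neg_div]; gcongr; exact h.1
  rw [Finset.mem_Icc]
  constructor
  · rw [Int.le_floor]; push_cast; linarith
  · have h3 := (Int.floor_le (t / e)).trans (h1.trans hc)
    exact_mod_cast h3

theorem abs_sub_le_of_floor_div_eq {t t' e : ℝ} (he : 0 < e) (h : ⌊t / e⌋ = ⌊t' / e⌋) :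
    |t - t'| ≤ e := by
  have := (Int.abs_sub_lt_one_of_floor_eq_floor h).le
  rwa [← sub_div, abs_div, abs_of_pos he, div_le_one he] at this

theorem card_Icc_neg_self (n : ℕ) : (Finset.Icc (-(n : ℤ)) n).card = 2 * n + 1 := by
  rw [Int.card_Icc]; omega

/-- Points in a dyadic shell whose last coordinate is the largest and at which `∂F/∂x₂` is not
small. One form is used for each cell of a grid with mesh `η` in all three affine coordinates,
refined to mesh `R ^ (-r)` in the first two; this accounts for the `O(R ^ (2 * r))` forms. -/
theorem exists_forms_on_shell {F : MvPolynomial (Fin 4) ℤ} {k : ℕ} (hF : F.IsHomogeneous k)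
    (N : ℕ) {c : ℝ} (hc : 0 < c) {r : ℝ} (hr : 0 < r) (hrk : r < k) {δ : ℕ} (hδ : 0 < δ) {W : ℝ}
    (hδW : (δ : ℝ) ≤ W)
    (hW : (W + 2 * r + k) ^ 4 / (24 * r ^ 2 * k) < Fintype.card (FormExponent δ) * (W - δ)) :
    ∃ K₁ R₀ : ℝ, ∀ R, R₀ ≤ R → ∃ S : Finset (MvPolynomial (Fin 4) ℤ),
      (∀ A ∈ S, A ≠ 0 ∧ A.IsHomogeneous δ) ∧ (S.card : ℝ) ≤ K₁ * R ^ (2 * r) ∧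
        ∀ x : Fin 4 → ℤ, R / 2 < |(x 3 : ℝ)| → |(x 3 : ℝ)| ≤ R → |eval x F| ≤ N →
          ratio x ∈ centres (dehom F) c → ∃ A ∈ S, eval x A = 0 := by
  classical
  have hk : 0 < k := by exact_mod_cast hr.trans hrk
  obtain ⟨η, K, hη, hK, hpatch⟩ := exists_patch_bound (dehom F) hc
  obtain ⟨R₁, hR₁, hform⟩ := exists_form_on_patch (dehom F) hc hr hk hδW hW
    (K := K) (U := 2 * (N * 2 ^ k)) (by linarith) (by positivity)
  obtain ⟨R₂, hR₂⟩ := Filter.eventually_atTop.1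
    ((tendsto_rpow_atTop (sub_pos.2 hrk)).eventually_ge_atTop ((N : ℝ) * 2 ^ k))
  refine ⟨(2 * ⌈1 / η⌉₊ + 1 : ℕ) ^ 3 * 25, max R₁ R₂, fun R hR => ?_⟩
  have hRR₁ : R₁ ≤ R := (le_max_left _ _).trans hR
  have hR1 : 1 ≤ R := hR₁.trans hRR₁
  have hR0 : 0 < R := by linarith
  have hρ : 0 < R ^ (-r) := by positivity
  have hRk : N * 2 ^ k * R ^ (-k : ℝ) ≤ R ^ (-r) := by
    calc N * 2 ^ k * R ^ (-k : ℝ) ≤ R ^ (k - r) * R ^ (-k : ℝ) :=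
          mul_le_mul_of_nonneg_right (hR₂ R ((le_max_right _ _).trans hR)) (by positivity)
      _ = R ^ (-r) := by rw [← Real.rpow_add hR0]; congr 1; ring
  let P : (Fin 4 → ℤ) → Prop := fun x => x 3 ≠ 0 ∧ |(x 3 : ℝ)| ≤ R ∧
    |eval (ratio x) (dehom F)| ≤ N * 2 ^ k * R ^ (-k : ℝ) ∧ ratio x ∈ centres (dehom F) c
  let cell : (Fin 4 → ℤ) → (Fin 3 → ℤ) × ℤ × ℤ := fun x =>
    (fun i => ⌊ratio x i / η⌋, ⌊ratio x 0 / R ^ (-r)⌋, ⌊ratio x 1 / R ^ (-r)⌋)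
  have hcell : ∀ v, ∃ A : MvPolynomial (Fin 4) ℤ, (A ≠ 0 ∧ A.IsHomogeneous δ) ∧
      ∀ x, P x → cell x = v → eval x A = 0 := by
    intro v
    by_cases hv : ∃ x₀, P x₀ ∧ cell x₀ = v
    · obtain ⟨x₀, ⟨-, -, h₀, ha⟩, hx₀⟩ := hv
      obtain ⟨A, hA, hAx⟩ := hform R hRR₁ (ratio x₀) ha
      refine ⟨A, hA, fun x ⟨hx3, hxR, hxF, hxc⟩ hx => ?_⟩
      rw [← hx₀] at hx
      simp only [cell, Prod.mk.injEq] at hx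
      have hu : |eval (ratio x) (dehom F) - eval (ratio x₀) (dehom F)|
          ≤ 2 * (N * 2 ^ k) * R ^ (-k : ℝ) :=
        (abs_sub _ _).trans (by linarith)
      refine hAx x hx3 hxR ?_ hu
      refine hpatch _ ha (R ^ (-r)) (ratio x - ratio x₀) ?_ ?_ ?_ ?_
      · exact fun i => abs_sub_le_of_floor_div_eq hη (congrFun hx.1 i)
      · exact abs_sub_le_of_floor_div_eq hρ hx.2.1
      · exact abs_sub_le_of_floor_div_eq hρ hx.2.2
      -- `r < k` makes the variation of `f` at most `2 * R ^ (-r)`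
      · rw [add_sub_cancel]
        exact hu.trans (by linarith)
    · obtain ⟨A, hA, -⟩ := exists_form_vanishing hδ 0
      exact ⟨A, hA, fun x hx hxv => (hv ⟨x, hx, hxv⟩).elim⟩
  choose A hA hAx using hcell
  set ℓ := ⌈1 / η⌉₊
  set n := ⌈1 / R ^ (-r)⌉₊ with hn
  let B : Finset ((Fin 3 → ℤ) × ℤ × ℤ) :=
    Fintype.piFinset (fun _ => Finset.Icc (-(ℓ : ℤ)) ℓ) ×ˢ
      Finset.Icc (-(n : ℤ)) n ×ˢ Finset.Icc (-(n : ℤ)) n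
  have hB : B.card = (2 * ℓ + 1) ^ 3 * ((2 * n + 1) * (2 * n + 1)) := by
    simp only [B, Finset.card_product, Fintype.card_piFinset, card_Icc_neg_self, Finset.prod_const,
      Finset.card_univ, Fintype.card_fin]
  refine ⟨B.image A, ?_, ?_, fun x hx1 hx2 hxF hxc => ?_⟩
  · intro A' hA'
    obtain ⟨v, -, rfl⟩ := Finset.mem_image.1 hA'
    exact hA v
  · have h1 : ((B.image A).card : ℝ) ≤ B.card := by exact_mod_cast Finset.card_image_le
    refine h1.trans ?_
    have h2 : (2 * n + 1 : ℝ) ≤ 5 * R ^ r := by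
      have h3 : (n : ℝ) < 1 / R ^ (-r) + 1 := Nat.ceil_lt_add_one (by positivity)
      have h4 : 1 ≤ R ^ r := Real.one_le_rpow hR1 hr.le
      rw [Real.rpow_neg hR0.le, one_div, inv_inv] at h3
      linarith
    have h5 : (2 * n + 1 : ℝ) * (2 * n + 1) ≤ 25 * R ^ (2 * r) := by
      calc (2 * n + 1 : ℝ) * (2 * n + 1) ≤ (5 * R ^ r) * (5 * R ^ r) := by gcongr
        _ = 25 * R ^ (2 * r) := by rw [two_mul r, Real.rpow_add hR0]; ring
    rw [hB]
    push_cast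
    rw [mul_assoc]
    gcongr
  · have hx3 : x 3 ≠ 0 := fun h => by
      rw [h, Int.cast_zero, abs_zero] at hx1; linarith
    have hF' : |eval (ratio x) (dehom F)| ≤ N * 2 ^ k * R ^ (-k : ℝ) := by
      have h1 : |((eval x F : ℤ) : ℝ)| ≤ N := by exact_mod_cast hxF
      rw [eval_eq_pow_mul_eval_ratio hF hx3, abs_mul, abs_pow] at h1
      have h2 : (R / 2) ^ k * |eval (ratio x) (dehom F)| ≤ N :=
        le_trans (mul_le_mul_of_nonneg_right (pow_le_pow_left₀ (by positivity) hx1.le _)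
          (abs_nonneg _)) h1
      rw [Real.rpow_neg hR0.le, Real.rpow_natCast, ← div_eq_mul_inv, le_div_iff₀ (by positivity)]
      rw [div_pow, div_mul_eq_mul_div, div_le_iff₀ (by positivity)] at h2
      linarith
    refine ⟨A (cell x), Finset.mem_image_of_mem _ ?_, hAx _ x ⟨hx3, hx2, hF', hxc⟩ rfl⟩
    simp only [B, cell, Finset.mem_product, Fintype.mem_piFinset]
    exact ⟨fun i => floor_div_mem_Icc hη (hxc.1 i), floor_div_mem_Icc hρ (hxc.1 0),
      floor_div_mem_Icc hρ (hxc.1 1)⟩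

/-! ### Non-singularity -/

/-- On the face `z i = 1` of the unit cube, near the surface `F = 0`, some partial derivative other
than the `i`-th is bounded away from zero: by Euler's identity the `i`-th one vanishes on the
surface as soon as the others do, so compactness applies to `|F| + ∑ |∂ⱼF|` over `j ≠ i`. -/
theorem exists_partial_derivative_bound {F : MvPolynomial (Fin 4) ℤ} {k : ℕ}
    (hF : F.IsHomogeneous k) (hns : IsNonsingularForm F) :
    ∃ c : ℝ, 0 < c ∧ ∀ (i : Fin 4) (z : Fin 4 → ℝ), (∀ l, |z l| ≤ 1) → z i = 1 →
      |aeval z F| < c → ∃ j, j ≠ i ∧ c ≤ |aeval z (pderiv j F)| := by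
  classical
  have hcont : ∀ G : MvPolynomial (Fin 4) ℤ, Continuous fun z : Fin 4 → ℝ => aeval z G := by
    intro G
    have h : (fun z : Fin 4 → ℝ => aeval z G) = fun z => eval z (map (algebraMap ℤ ℝ) G) := by
      ext z; rw [eval_map, aeval_def]
    rw [h]
    exact MvPolynomial.continuous_eval _
  have hmin : ∀ i : Fin 4, ∃ c : ℝ, 0 < c ∧ ∀ z : Fin 4 → ℝ, (∀ l, |z l| ≤ 1) → z i = 1 →
      4 * c ≤ |aeval z F| + ∑ j ∈ Finset.univ.erase i, |aeval z (pderiv j F)| := by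
    intro i
    let φ : (Fin 4 → ℝ) → ℝ :=
      fun z => |aeval z F| + ∑ j ∈ Finset.univ.erase i, |aeval z (pderiv j F)|
    have hφ : Continuous φ :=
      (hcont F).abs.add (continuous_finsetSum _ fun j _ => (hcont _).abs)
    have hK : IsCompact ((Set.univ.pi fun _ : Fin 4 => Set.Icc (-1 : ℝ) 1) ∩ {z | z i = 1}) :=
      (isCompact_univ_pi fun _ => isCompact_Icc).inter_right
        (isClosed_eq (continuous_apply i) continuous_const)
    obtain ⟨z₀, ⟨-, hz₀⟩, hz₀min⟩ := hK.exists_isMinOn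
      ⟨fun _ => 1, fun _ _ => ⟨by norm_num, le_refl _⟩, rfl⟩ hφ.continuousOn
    have hpos : 0 < φ z₀ := by
      refine lt_of_le_of_ne (by positivity) fun h0 => ?_
      have hs : 0 ≤ ∑ j ∈ Finset.univ.erase i, |aeval z₀ (pderiv j F)| := by positivity
      have hF0 : aeval z₀ F = 0 := by
        have := abs_nonneg (aeval z₀ F)
        exact abs_eq_zero.1 (by simp only [φ] at h0; linarith)
      have hd : ∀ j ≠ i, aeval z₀ (pderiv j F) = 0 := by
        have h1 : ∑ j ∈ Finset.univ.erase i, |aeval z₀ (pderiv j F)| = 0 := by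
          simp only [φ, hF0, abs_zero] at h0; linarith
        rw [Finset.sum_eq_zero_iff_of_nonneg fun _ _ => abs_nonneg _] at h1
        exact fun j hj => abs_eq_zero.1 (h1 j (Finset.mem_erase.2 ⟨hj, Finset.mem_univ j⟩))
      have hdi : aeval z₀ (pderiv i F) = 0 := by
        have h1 := congrArg (aeval z₀) hF.sum_X_mul_pderiv
        rw [map_nsmul, hF0, smul_zero, map_sum, Finset.sum_eq_single i] at h1
        · rw [map_mul, aeval_X, show z₀ i = 1 from hz₀, one_mul] at h1
          exact h1
        · intro j _ hj; rw [map_mul, hd j hj, mul_zero]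
        · simp
      have hC : ∀ G : MvPolynomial (Fin 4) ℤ, aeval z₀ G = 0 →
          aeval (algebraMap ℝ ℂ ∘ z₀) G = 0 := fun G hG => by
        rw [aeval_algebraMap_apply, hG, map_zero]
      have := congrFun (hns _ (hC F hF0) fun j => hC _ (by
        by_cases hj : j = i
        · rw [hj]; exact hdi
        · exact hd j hj)) i
      rw [Function.comp_apply, show z₀ i = 1 from hz₀, map_one] at this
      exact one_ne_zero this
    refine ⟨φ z₀ / 4, by positivity, fun z hz hzi => ?_⟩
    have := hz₀min (a := z) ⟨fun l _ => abs_le.1 (hz l), hzi⟩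
    simp only [Set.mem_ofPred_eq] at this
    linarith
  choose c hc0 hc using hmin
  obtain ⟨i₀, -, hi₀⟩ := Finset.exists_min_image Finset.univ c ⟨0, Finset.mem_univ _⟩
  refine ⟨c i₀, hc0 i₀, fun i z hz hzi hzF => ?_⟩
  by_contra! hcon
  have h1 := hc i z hz hzi
  have h2 : ∑ j ∈ Finset.univ.erase i, |aeval z (pderiv j F)| ≤ 3 * c i₀ := by
    refine (Finset.sum_le_card_nsmul _ _ (c i₀) fun j hj => ?_).trans (le_of_eq ?_)
    · exact (hcon j (Finset.ne_of_mem_erase hj)).le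
    · rw [Finset.card_erase_of_mem (Finset.mem_univ i)]; simp
  have := hi₀ i (Finset.mem_univ i)
  linarith

theorem exists_perm_three_two {i j : Fin 4} (h : j ≠ i) :
    ∃ σ : Equiv.Perm (Fin 4), σ 3 = i ∧ σ 2 = j := by
  refine ⟨Equiv.swap 3 i * Equiv.swap 2 (Equiv.swap 3 i j), ?_, by simp⟩
  have h3 : Equiv.swap 3 i j ≠ 3 := fun h3 =>
    h ((Equiv.swap 3 i).injective (h3.trans (Equiv.swap_apply_right 3 i).symm))
  rw [Equiv.Perm.mul_apply, Equiv.swap_apply_of_ne_of_ne (by decide : (3 : Fin 4) ≠ 2) h3.symm,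
    Equiv.swap_apply_left]

/-- A permutation of the coordinates moves the largest coordinate of `x` to the last place and the
large partial derivative to the place before it. -/
theorem ratio_mem_centres_of_perm {F : MvPolynomial (Fin 4) ℤ} {c : ℝ} {x : Fin 4 → ℤ}
    {σ : Equiv.Perm (Fin 4)} (hx : ∀ l, |x l| ≤ |x (σ 3)|) (hx0 : x (σ 3) ≠ 0)
    (hc : c ≤ |aeval (fun l => (x l : ℝ) / x (σ 3)) (pderiv (σ 2) F)|) :
    ratio (x ∘ σ) ∈ centres (dehom (rename σ.symm F)) c := by
  have hx0' : (x (σ 3) : ℝ) ≠ 0 := by exact_mod_cast hx0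
  refine ⟨fun i => ?_, ?_⟩
  · rw [ratio, abs_div]
    refine div_le_one_of_le₀ ?_ (abs_nonneg _)
    exact_mod_cast hx (σ i.castSucc)
  · have h2 : pderiv 2 (rename σ.symm F) = rename σ.symm (pderiv (σ 2) F) := by
      have := pderiv_rename σ.symm.injective (σ 2) F
      rwa [Equiv.symm_apply_apply] at this
    have hz : ![ratio (x ∘ σ) 0, ratio (x ∘ σ) 1, ratio (x ∘ σ) 2, 1] ∘ σ.symm
        = fun l => (x l : ℝ) / x (σ 3) := by
      ext l
      obtain ⟨m, rfl⟩ := σ.surjective l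
      rw [Function.comp_apply, Equiv.symm_apply_apply]
      fin_cases m <;> simp [ratio, hx0']
    rw [pderiv_two_dehom, eval_dehom, h2, aeval_rename, hz]
    exact hc

/-! ### Summation over dyadic shells -/

/-- Forms of degree `δ` such that each of the points `x` with `R / 2 < max |xᵢ| ≤ R` and
`|F x| ≤ N` is a zero of one of them. -/
theorem exists_forms_on_shell_of_nonsingular {F : MvPolynomial (Fin 4) ℤ} {k : ℕ}
    (hF : F.IsHomogeneous k) (hns : IsNonsingularForm F)
    (N : ℕ) {r : ℝ} (hr : 0 < r) (hrk : r < k) {δ : ℕ} (hδ : 0 < δ) {W : ℝ}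
    (hδW : (δ : ℝ) ≤ W)
    (hW : (W + 2 * r + k) ^ 4 / (24 * r ^ 2 * k) < Fintype.card (FormExponent δ) * (W - δ)) :
    ∃ K₁ R₀ : ℝ, 0 ≤ K₁ ∧ 1 ≤ R₀ ∧ ∀ R, R₀ ≤ R → ∃ S : Finset (MvPolynomial (Fin 4) ℤ),
      (∀ A ∈ S, A ≠ 0 ∧ A.IsHomogeneous δ) ∧ (S.card : ℝ) ≤ K₁ * R ^ (2 * r) ∧
        ∀ x : Fin 4 → ℤ, (∀ i, |(x i : ℝ)| ≤ R) → (∃ i, R / 2 < |(x i : ℝ)|) → |eval x F| ≤ N →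
          ∃ A ∈ S, eval x A = 0 := by
  classical
  obtain ⟨c, hc, hcF⟩ := exists_partial_derivative_bound hF hns
  choose K₁ R₀ hS using fun σ : Equiv.Perm (Fin 4) => exists_forms_on_shell
    (hF.rename_isHomogeneous (f := σ.symm)) N hc hr hrk hδ hδW hW
  have hk : (0 : ℝ) < k := hr.trans hrk
  obtain ⟨R₁, hR₁⟩ := Filter.eventually_atTop.1
    ((tendsto_rpow_atTop hk).eventually_gt_atTop ((N : ℝ) * 2 ^ k / c))
  refine ⟨∑ σ, |K₁ σ|, max (max 1 R₁) (∑ σ, |R₀ σ|), by positivity,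
    (le_max_left _ _).trans (le_max_left _ _), fun R hR => ?_⟩
  have hR1 : 1 ≤ R := (le_max_left _ _).trans ((le_max_left _ _).trans hR)
  have hR0 : 0 < R := by linarith
  have hRk := hR₁ R ((le_max_right _ _).trans ((le_max_left _ _).trans hR))
  rw [div_lt_iff₀ hc, Real.rpow_natCast] at hRk
  have hRσ : ∀ σ, R₀ σ ≤ R := fun σ => (le_abs_self _).trans
    ((Finset.single_le_sum (f := fun σ => |R₀ σ|) (fun _ _ => abs_nonneg _)
      (Finset.mem_univ σ)).trans ((le_max_right _ _).trans hR))
  choose S hSA hScard hSx using fun σ => hS σ R (hRσ σ)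
  refine ⟨Finset.univ.biUnion fun σ : Equiv.Perm (Fin 4) => (S σ).image (rename σ), ?_, ?_, ?_⟩
  · intro A hA
    obtain ⟨σ, -, hA⟩ := Finset.mem_biUnion.1 hA
    obtain ⟨A, hA', rfl⟩ := Finset.mem_image.1 hA
    obtain ⟨h1, h2⟩ := hSA σ A hA'
    refine ⟨fun h => h1 (rename_injective _ σ.injective (by rw [h, map_zero])),
      h2.rename_isHomogeneous⟩
  · rw [Finset.sum_mul]
    refine (Nat.cast_le.2 Finset.card_biUnion_le).trans ?_
    push_cast
    refine Finset.sum_le_sum fun σ _ => ?_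
    have h1 : (((S σ).image (rename σ)).card : ℝ) ≤ (S σ).card := by
      exact_mod_cast Finset.card_image_le
    exact h1.trans ((hScard σ).trans
      (mul_le_mul_of_nonneg_right (le_abs_self _) (by positivity)))
  · intro x hx ⟨i', hi'⟩ hxF
    obtain ⟨i, -, hi⟩ := Finset.exists_max_image Finset.univ (fun i => |x i|)
      ⟨i', Finset.mem_univ _⟩
    have hi : ∀ l, |x l| ≤ |x i| := fun l => hi l (Finset.mem_univ l)
    have hiR : R / 2 < |(x i : ℝ)| := hi'.trans_le (by exact_mod_cast hi i')
    have hxi : x i ≠ 0 := fun h => by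
      rw [h, Int.cast_zero, abs_zero] at hiR; linarith
    have hxi' : (x i : ℝ) ≠ 0 := by exact_mod_cast hxi
    -- `R₁ ≤ R` ensures that `|F|` is less than `c` at the rescaled point
    obtain ⟨j, hji, hj⟩ := hcF i (fun l => (x l : ℝ) / x i)
      (fun l => by
        rw [abs_div]
        exact div_le_one_of_le₀ (by exact_mod_cast hi l) (abs_nonneg _))
      (div_self hxi') (by
        have h1 := aeval_smul_of_isHomogeneous hF (x i : ℝ) (fun l => (x l : ℝ) / x i)
        have h2 : (fun l => (x i : ℝ) * ((x l : ℝ) / x i)) = fun l => (x l : ℝ) := by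
          ext l; field_simp
        have h3 : |((eval x F : ℤ) : ℝ)| ≤ N := by exact_mod_cast hxF
        rw [intCast_eval, ← h2, h1, abs_mul, abs_pow] at h3
        by_contra! hcon
        have h4 : (R / 2) ^ k * c ≤ N :=
          (mul_le_mul (pow_le_pow_left₀ (by positivity) hiR.le _) hcon hc.le
            (by positivity)).trans h3
        rw [div_pow, div_mul_eq_mul_div, div_le_iff₀ (by positivity)] at h4
        linarith)
    obtain ⟨σ, rfl, rfl⟩ := exists_perm_three_two hji
    obtain ⟨A, hA, hAx⟩ := hSx σ (x ∘ σ) hiR (hx _) (by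
      rw [eval_rename, Function.comp_assoc, Equiv.self_comp_symm, Function.comp_id]
      exact hxF) (ratio_mem_centres_of_perm hi hxi hj)
    exact ⟨rename σ A, Finset.mem_biUnion.2 ⟨σ, Finset.mem_univ _, Finset.mem_image_of_mem _ hA⟩,
      by rw [eval_rename]; exact hAx⟩

theorem exists_collection_bound {F : MvPolynomial (Fin 4) ℤ} {k : ℕ}
    (hF : F.IsHomogeneous k) (hns : IsNonsingularForm F)
    (N : ℕ) {r : ℝ} (hr : 0 < r) (hrk : r < k) {δ : ℕ} (hδ : 0 < δ) {W : ℝ}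
    (hδW : (δ : ℝ) ≤ W)
    (hW : (W + 2 * r + k) ^ 4 / (24 * r ^ 2 * k) < Fintype.card (FormExponent δ) * (W - δ)) :
    ∃ K : ℝ, 0 ≤ K ∧ ∀ B : ℝ, 1 ≤ B → (auxiliaryNumber F N B δ : ℝ) ≤ K * B ^ (2 * r) := by
  classical
  obtain ⟨K₁, R₀, hK₁, hR₀, hS⟩ := exists_forms_on_shell_of_nonsingular hF hns N hr hrk hδ hδW hW
  have h2 : (1 : ℝ) < 2 ^ (2 * r) := Real.one_lt_rpow (by norm_num) (by positivity)
  obtain ⟨C₀, hC₀, -⟩ := auxiliaryNumber_attained F N R₀ hδ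
  -- chosen so that `K * ρ ^ (2 * r) + K₁ * (2 * ρ) ^ (2 * r) ≤ K * (2 * ρ) ^ (2 * r)`
  obtain ⟨K, hK⟩ : ∃ K : ℝ, K = C₀.card + K₁ * 2 ^ (2 * r) / (2 ^ (2 * r) - 1) := ⟨_, rfl⟩
  have hfrac : 0 ≤ K₁ * 2 ^ (2 * r) / ((2 : ℝ) ^ (2 * r) - 1) :=
    div_nonneg (by positivity) (by linarith)
  have hK0 : 0 ≤ K := by rw [hK]; positivity
  have hK₁K : K₁ * 2 ^ (2 * r) ≤ K * (2 ^ (2 * r) - 1) := by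
    rw [← div_le_iff₀ (by linarith), hK]
    linarith [Nat.cast_nonneg (α := ℝ) C₀.card]
  have hdyadic : ∀ n : ℕ, ∃ C, IsAuxiliaryCollection F N (R₀ * 2 ^ n) δ C ∧
      (C.card : ℝ) ≤ K * (R₀ * 2 ^ n) ^ (2 * r) := by
    intro n
    induction n with
    | zero =>
      refine ⟨C₀, by simpa using hC₀, ?_⟩
      have h1 : 1 ≤ R₀ ^ (2 * r) := Real.one_le_rpow hR₀ (by positivity)
      rw [pow_zero, mul_one]
      calc (C₀.card : ℝ) ≤ K := by rw [hK]; linarith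
        _ ≤ K * R₀ ^ (2 * r) := le_mul_of_one_le_right hK0 h1
    | succ n ih =>
      obtain ⟨C, ⟨hC, hCx⟩, hCcard⟩ := ih
      have hn : R₀ * 2 ^ (n + 1) = 2 * (R₀ * 2 ^ n) := by ring
      obtain ⟨ρ, hρ⟩ : ∃ ρ, ρ = R₀ * 2 ^ n := ⟨_, rfl⟩
      rw [hn]
      rw [← hρ] at hCx hCcard ⊢
      have hρR : R₀ ≤ ρ := by
        rw [hρ]; exact le_mul_of_one_le_right (by linarith) (one_le_pow₀ (by norm_num))
      have hρ0 : 0 < ρ := by linarith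
      obtain ⟨S, hSA, hScard, hSx⟩ := hS (2 * ρ) (by linarith)
      refine ⟨C ∪ S, ⟨fun A hA => ?_, fun x hx => ?_⟩, ?_⟩
      · exact (Finset.mem_union.1 hA).elim (hC A) (hSA A)
      · by_cases hxρ : ∀ i, |(x i : ℝ)| ≤ ρ
        · obtain ⟨A, hA, hAx⟩ := hCx x ⟨hxρ, hx.2⟩
          exact ⟨A, Finset.mem_union_left _ hA, hAx⟩
        · push Not at hxρ
          obtain ⟨i, hi⟩ := hxρ
          obtain ⟨A, hA, hAx⟩ := hSx x hx.1 ⟨i, by linarith⟩ hx.2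
          exact ⟨A, Finset.mem_union_right _ hA, hAx⟩
      · have h3 : ((C ∪ S).card : ℝ) ≤ C.card + S.card := by
          exact_mod_cast Finset.card_union_le _ _
        rw [Real.mul_rpow (by norm_num) hρ0.le] at hScard ⊢
        have h4 := mul_le_mul_of_nonneg_right hK₁K (show 0 ≤ ρ ^ (2 * r) by positivity)
        linarith
  refine ⟨K * (2 * R₀) ^ (2 * r), by positivity, fun B hB => ?_⟩
  obtain ⟨n, hn1, hn2⟩ := exists_nat_pow_near hB (one_lt_two (α := ℝ))
  obtain ⟨C, ⟨hC, hCx⟩, hCcard⟩ := hdyadic (n + 1)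
  have hB2 : B ≤ R₀ * 2 ^ (n + 1) := hn2.le.trans (le_mul_of_one_le_left (by positivity) hR₀)
  have hle : auxiliaryNumber F N B δ ≤ C.card :=
    Nat.sInf_le ⟨C, ⟨hC, fun x hx => hCx x ⟨fun i => (hx.1 i).trans hB2, hx.2⟩⟩, rfl⟩
  calc (auxiliaryNumber F N B δ : ℝ) ≤ C.card := by exact_mod_cast hle
    _ ≤ K * (R₀ * 2 ^ (n + 1)) ^ (2 * r) := hCcard
    _ ≤ K * (2 * R₀ * B) ^ (2 * r) := by
        refine mul_le_mul_of_nonneg_left (Real.rpow_le_rpow (by positivity) ?_ (by positivity)) hK0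
        rw [pow_succ]
        linarith [mul_le_mul_of_nonneg_left hn1 (show 0 ≤ R₀ by linarith)]
    _ = K * (2 * R₀) ^ (2 * r) * B ^ (2 * r) := by
        rw [Real.mul_rpow (by positivity) (by linarith), mul_assoc]

theorem proposition3p2 (k : ℕ) (hk : 3 ≤ k) (ε : ℝ) (hε : 0 < ε) :
    ∃ δ : ℕ, 0 < δ ∧
      ∀ F : MvPolynomial (Fin 4) ℤ, F.IsHomogeneous k → IsNonsingularForm F →
        ∀ N : ℕ, ∃ K : ℝ, ∀ B : ℝ, 1 ≤ B →
          (auxiliaryNumber F N B δ : ℝ) ≤ K * B ^ (16 / (3 * Real.sqrt (3 * (k : ℝ))) + ε) := by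
  have hk3 : (3 : ℝ) ≤ k := by exact_mod_cast hk
  have hk0 : (0 : ℝ) < k := by linarith
  have hsq : Real.sqrt (3 * k) ^ 2 = 3 * k := Real.sq_sqrt (by positivity)
  have hsqrt : 3 ≤ Real.sqrt (3 * k) := Real.le_sqrt_of_sq_le (by linarith)
  obtain ⟨r₀, hr₀⟩ : ∃ r₀, r₀ = 8 / (3 * Real.sqrt (3 * (k : ℝ))) := ⟨_, rfl⟩
  have hr₀0 : 0 < r₀ := by rw [hr₀]; positivity
  have hr₀1 : r₀ ≤ 1 := by
    rw [hr₀, div_le_one (by positivity)]; linarith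
  have hr₀k : r₀ ^ 2 * k = 64 / 27 := by
    rw [hr₀, div_pow, mul_pow, hsq]
    field_simp
    norm_num
  -- `r₀` is the critical exponent, `r₀ ^ 2 * k = 64 / 27`; the `min` keeps `r` below `k`
  obtain ⟨r, hr⟩ : ∃ r, r = r₀ + min ε 1 / 2 := ⟨_, rfl⟩
  have hmin : 0 < min ε 1 := lt_min hε one_pos
  have hrr₀ : r₀ < r := by linarith
  have hr0 : 0 < r := by linarith
  have hrk : r < k := by linarith [min_le_right ε 1]
  have hr2 : 64 / 27 < r ^ 2 * k := by
    rw [← hr₀k]; gcongr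
  obtain ⟨δ, hδ, hW⟩ := exists_degree hr0 hk0 hr2
  refine ⟨δ, hδ, fun F hF hns N => ?_⟩
  obtain ⟨K, hK, hB⟩ := exists_collection_bound hF hns N hr0 hrk hδ
    (by linarith [Nat.cast_nonneg (α := ℝ) δ] : (δ : ℝ) ≤ 4 / 3 * δ) hW
  refine ⟨K, fun B hB1 => (hB B hB1).trans ?_⟩
  refine mul_le_mul_of_nonneg_left (Real.rpow_le_rpow_of_exponent_le hB1 ?_) hK
  have h16 : 16 / (3 * Real.sqrt (3 * (k : ℝ))) = 2 * r₀ := by rw [hr₀]; ring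
  rw [h16]
  linarith [min_le_left ε 1]
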